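/- Let $\Omega\subset\mathbb{R}^2$ be a bounded domain with boundary of class $C^{1,1}$ and let $\nu>0$. Put $H=L^2(\Omega)$, $V=H^1(\Omega)$, $V_{div}=\{v\in H^1_0(\Omega)^2:\operatorname{div}v=0\}$, and let $G_{div}$ be the closure in $L^2(\Omega)^2$ of $\{v\in C_0^\infty(\Omega)^2:\operatorname{div}v=0\}$; $\|\cdot\|$ is the norm of $H$ and of $G_{div}$, $\overline f$ is the mean value of $f$ over $\Omega$, and $b(u,v,w)=\int_\Omega (u\cdot\nabla)v\cdot w$. *Kernel.* $J:\mathbb{R}^2\to\mathbb{R}$ is measurable and even, $J(\cdot-x)\in W^{1,1}(\Omega)$ for a.e. $x\in\Omega$, $a(x):=\int_\Omega J(x-y)\,dy\ge 0$ for a.e. $x\in\Omega$, and $$a^*:=\sup_{x\in\Omega}\int_\Omega|J(x-y)|\,dy<\infty,\qquad \sup_{x\in\Omega}\int_\Omega|\nabla J(x-y)|\,dy<\infty .$$ Let $a_*:=\inf_{x\in\Omega}a(x)$. For $f$ on $\Omega$, $(J*f)(x)=\int_\Omega J(x-y)f(y)\,dy$, $(\nabla J*f)(x)=\int_\Omega\nabla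 J(x-y)f(y)\,dy$, and $\nabla a(x)=\int_\Omega \nabla J(x-y)\,dy$. *Mobility and potential.* $m\in C^1([-1,1])$, $m\ge0$, and $m(s)=0$ if and only if $s=\pm1$. $F=F_1+F_2$ with $F_1\in C^2(-1,1)$ and $F_2\in C^2([-1,1])$, and $mF''$ extends continuously from $(-1,1)$ to $[-1,1]$ (the extension is again denoted by $mF''$; then $mF_1''$ extends as well). Moreover: * there are $a_2>4(a^*-a_*-\min_{[-1,1]}F_2'')$ and $\varepsilon_0>0$ such that $F_1''\ge a_2$ on $(-1,-1+\varepsilon_0]\cup[1-\varepsilon_0,1)$; * there is $\varepsilon_0>0$ such that $F_1''$ is non-decreasing on $[1-\varepsilon_0,1)$ and non-increasing on $(-1,-1+\varepsilon_0]$; * there is $c_0>0$ with $F''(s)+a(x)\ge c_0$ for all $s\in(-1,1)$ and a.e. $x\in\Omega$; * there are $\rho\in[0,1)$ and $\alpha_0>0$ with $\rho F_1''(s)+F_2''(s)+a(x)\ge0$ for all $s\in(-1,1)$ and a.e. $x\in\Omega$, and $m(s)F_1''(s)\ge\alpha_0$ for all $s\in[-1,1]$. *Force.* $h\in V_{div}'$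 is independent of time. *Weak solutions.* For $0<T<\infty$, a weak solution on $[0,T]$ with initial datum $[u_0,\varphi_0]$ is a pair $[u,\varphi]$ with $u\in L^\infty(0,T;G_{div})\cap L^2(0,T;V_{div})$, $u_t\in L^2(0,T;V_{div}')$, $\varphi\in L^\infty(0,T;H)\cap L^2(0,T;V)$, $\varphi_t\in L^2(0,T;V')$, $|\varphi|\le1$ a.e. in $\Omega\times(0,T)$, such that for every $\psi\in V$, every $v\in V_{div}$ and almost every $t\in(0,T)$ $$\langle\varphi_t,\psi\rangle+\int_\Omega m(\varphi)F''(\varphi)\nabla\varphi\cdot\nabla\psi+\int_\Omega m(\varphi)a\nabla\varphi\cdot\nabla\psi+\int_\Omega m(\varphi)(\varphi\nabla a-\nabla J*\varphi)\cdot\nabla\psi=\int_\Omega \varphi\, u\cdot\nabla\psi,$$ $$\langle u_t,v\rangle+\nu\int_\Omega\nabla u:\nabla v+b(u,u,v)=\int_\Omega(a\varphi-J*\varphi)\nabla\varphi\cdot v+\langle h,v\rangle,$$ and $u(0)=u_0$, $\varphi(0)=\varphi_0$, where $u$ and $\varphi$ are taken as their weakly continuous representatives $[0,T]\to G_{div}$,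 $[0,T]\to H$. *Phase space.* For $m_0\in[0,1]$ let $\mathcal{X}_{m_0}=G_{div}\times\mathcal{Y}_{m_0}$, where $\mathcal{Y}_{m_0}$ is the set of all $\varphi\in L^\infty(\Omega)$ with $|\varphi|\le1$ a.e., $F(\varphi)\in L^1(\Omega)$ (with $F(\pm1)$ the limits of $F$ at $\pm1$ in $(-\infty,+\infty]$) and $|\overline\varphi|\le m_0$. The metric is $d([u_2,\varphi_2],[u_1,\varphi_1])=\|u_2-u_1\|+\|\varphi_2-\varphi_1\|$. Let $\mathcal{G}_{m_0}$ be the set of all $z=[u,\varphi]:[0,\infty)\to G_{div}\times H$ with $z(0)\in\mathcal{X}_{m_0}$ that are weak solutions on $[0,T]$, with initial datum $z(0)$, for every $T>0$. *Claim.* There are constants $\eta>0$ and $C\ge0$, depending neither on the solution nor on $m_0$, such that for all $m_0\in[0,1]$, all $z=[u,\varphi]\in\mathcal{G}_{m_0}$ and all $t\ge0$, with $\overline{\varphi}_0=\overline{\varphi(0)}$, $$\|u(t)\|^2+\|\varphi(t)-\overline{\varphi}_0\|^2\le\big(\|u(0)\|^2+\|\varphi(0)-\overline{\varphi}_0\|^2\big)e^{-\eta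 t}+C .$$ Moreover, for every $m_0\in[0,1]$, $\mathcal{G}_{m_0}$ is * point dissipative: there is a set $B_0$, bounded with respect to $d$, such that for every $z\in\mathcal{G}_{m_0}$ one has $z(t)\in B_0$ for all sufficiently large $t$; * eventually bounded: for every set $B$ bounded with respect to $d$ there is $\tau\ge0$ such that $\{z(t):z\in\mathcal{G}_{m_0},\ z(0)\in B,\ t\ge\tau\}$ is bounded with respect to $d$. -/

import Mathlib

open MeasureTheory Set Filter Topology
open scoped NNReal ENNReal ContDiff

noncomputable section

namespace NonlocalCHNS

/-- The Euclidean plane. -/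
abbrev Plane := EuclideanSpace ℝ (Fin 2)

/-! ### Domains -/

/-- `∂Ω` is of class `C^{1,1}`: near each boundary point, in suitable Cartesian coordinates,
`Ω` is the strict epigraph of a differentiable function with Lipschitz derivative. -/
def HasC11Boundary (Ω : Set Plane) : Prop :=
  ∀ p ∈ frontier Ω, ∃ (L : Plane ≃ₗᵢ[ℝ] Plane) (γ : ℝ → ℝ) (K : ℝ≥0) (r : ℝ),
    0 < r ∧ Differentiable ℝ γ ∧ LipschitzWith K (deriv γ) ∧
      ∀ x ∈ Metric.ball p r, x ∈ Ω ↔ γ (L x 0) < L x 1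

/-- A bounded domain (nonempty connected open set) of class `C^{1,1}`. -/
structure IsC11Domain (Ω : Set Plane) : Prop where
  isOpen : IsOpen Ω
  isConnected : IsConnected Ω
  isBounded : Bornology.IsBounded Ω
  boundary : HasC11Boundary Ω

/-! ### Function spaces -/

/-- The space `H = L²(Ω)`. -/
abbrev L2 (Ω : Set Plane) := Lp ℝ 2 (volume.restrict Ω)

/-- The space `L²(Ω)²`, with norm `(‖u₁‖² + ‖u₂‖²)^{1/2}`. -/
abbrev L2Vec (Ω : Set Plane) := PiLp 2 (fun _ : Fin 2 => L2 Ω)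

/-- The classical partial derivative `∂ᵢ f`. -/
def pd (i : Fin 2) (f : Plane → ℝ) (x : Plane) : ℝ :=
  fderiv ℝ f x (EuclideanSpace.single i 1)

/-- `η ∈ C₀^∞(Ω)`. -/
structure IsTest (Ω : Set Plane) (η : Plane → ℝ) : Prop where
  smooth : ContDiff ℝ ∞ η
  compact : HasCompactSupport η
  support : tsupport η ⊆ Ω

/-- `g` is the weak gradient of `f` in `Ω` (used for integrable `f`, `g`). -/
def IsWeakGrad (Ω : Set Plane) (f : Plane → ℝ) (g : Fin 2 → Plane → ℝ) : Prop :=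
  ∀ η, IsTest Ω η → ∀ i, ∫ x in Ω, f x * pd i η x = - ∫ x in Ω, g i x * η x

lemma IsTest.memLp {Ω : Set Plane} {η : Plane → ℝ} (h : IsTest Ω η) :
    MemLp η 2 (volume.restrict Ω) :=
  (h.smooth.continuous.memLp_of_hasCompactSupport h.compact).restrict Ω

lemma IsTest.memLp_pd {Ω : Set Plane} {η : Plane → ℝ} (h : IsTest Ω η) (i : Fin 2) :
    MemLp (pd i η) 2 (volume.restrict Ω) := by
  refine MemLp.restrict Ω ?_
  have hc : Continuous (pd i η) :=
    (h.smooth.continuous_fderiv (by simp)).clm_apply continuous_const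
  refine hc.memLp_of_hasCompactSupport ?_
  exact (h.compact.fderiv ℝ).comp_left (g := fun T : Plane →L[ℝ] ℝ =>
    T (EuclideanSpace.single i 1)) (by simp)

/-- The graph of the weak gradient: pairs `(f, ∇f)` with `f ∈ L²(Ω)`, `∇f ∈ L²(Ω)²` the weak
gradient of `f`. -/
def h1Graph (Ω : Set Plane) : Submodule ℝ (WithLp 2 (L2 Ω × L2Vec Ω)) where
  carrier := {w | IsWeakGrad Ω w.fst (fun i => w.snd i)}
  zero_mem' := by
    intro η _ i
    have h0 : ((0 : L2 Ω) : Plane → ℝ) =ᵐ[volume.restrict Ω] 0 := Lp.coeFn_zero _ _ _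
    have e1 : ∫ x in Ω, ((0 : L2 Ω) : Plane → ℝ) x * pd i η x = 0 := by
      rw [integral_congr_ae (g := fun _ => (0 : ℝ)) (by
        filter_upwards [h0] with x hx
        rw [hx]; simp)]
      simp
    have e2 : ∫ x in Ω, ((0 : L2 Ω) : Plane → ℝ) x * η x = 0 := by
      rw [integral_congr_ae (g := fun _ => (0 : ℝ)) (by
        filter_upwards [h0] with x hx
        rw [hx]; simp)]
      simp
    exact e1.trans (by rw [← neg_zero, ← e2]; rfl)
  add_mem' := by
    intro v w hv hw η hη i
    have a1 := Lp.coeFn_add v.fst w.fst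
    have a2 := Lp.coeFn_add (v.snd i) (w.snd i)
    have i1 : ∀ f : L2 Ω, Integrable (fun x => f x * pd i η x) (volume.restrict Ω) :=
      fun f => (Lp.memLp f).integrable_mul (hη.memLp_pd i)
    have i2 : ∀ f : L2 Ω, Integrable (fun x => f x * η x) (volume.restrict Ω) :=
      fun f => (Lp.memLp f).integrable_mul hη.memLp
    have e1 : ∫ x in Ω, (v + w).fst x * pd i η x
        = ∫ x in Ω, (v.fst x * pd i η x + w.fst x * pd i η x) :=
      integral_congr_ae (by
        filter_upwards [a1] with x hx
        rw [show (v + w).fst = v.fst + w.fst from rfl, hx, Pi.add_apply, add_mul])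
    have e2 : ∫ x in Ω, (v + w).snd i x * η x
        = ∫ x in Ω, (v.snd i x * η x + w.snd i x * η x) :=
      integral_congr_ae (by
        filter_upwards [a2] with x hx
        rw [show (v + w).snd i = v.snd i + w.snd i from rfl, hx, Pi.add_apply, add_mul])
    rw [e1, e2, integral_add (i1 _) (i1 _), integral_add (i2 _) (i2 _), hv η hη i, hw η hη i]
    ring
  smul_mem' := by
    intro c w hw η hη i
    have a1 := Lp.coeFn_smul c w.fst
    have a2 := Lp.coeFn_smul c (w.snd i)
    have e1 : ∫ x in Ω, (c • w).fst x * pd i η x = ∫ x in Ω, c * (w.fst x * pd i η x) :=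
      integral_congr_ae (by
        filter_upwards [a1] with x hx
        rw [show (c • w).fst = c • w.fst from rfl, hx, Pi.smul_apply, smul_eq_mul, mul_assoc])
    have e2 : ∫ x in Ω, (c • w).snd i x * η x = ∫ x in Ω, c * (w.snd i x * η x) :=
      integral_congr_ae (by
        filter_upwards [a2] with x hx
        rw [show (c • w).snd i = c • w.snd i from rfl, hx, Pi.smul_apply, smul_eq_mul, mul_assoc])
    rw [e1, e2, integral_const_mul, integral_const_mul, hw η hη i]
    ring

/-- The space `V = H¹(Ω)`, with the norm `(‖f‖² + ‖∇f‖²)^{1/2}`. -/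
def H1 (Ω : Set Plane) : Type := h1Graph Ω

instance (Ω : Set Plane) : NormedAddCommGroup (H1 Ω) :=
  inferInstanceAs (NormedAddCommGroup (h1Graph Ω))

instance (Ω : Set Plane) : InnerProductSpace ℝ (H1 Ω) :=
  inferInstanceAs (InnerProductSpace ℝ (h1Graph Ω))

/-- The `L²` function underlying an element of `H¹(Ω)`. -/
def h1Fn {Ω : Set Plane} (f : H1 Ω) : L2 Ω := f.1.fst

/-- The weak partial derivatives of an element of `H¹(Ω)`. -/
def h1Grad {Ω : Set Plane} (f : H1 Ω) (i : Fin 2) : L2 Ω := f.1.snd i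

lemma h1Grad_zero {Ω : Set Plane} (i : Fin 2) : h1Grad (0 : H1 Ω) i = 0 := rfl

lemma h1Grad_add {Ω : Set Plane} (f g : H1 Ω) (i : Fin 2) :
    h1Grad (f + g) i = h1Grad f i + h1Grad g i := rfl

lemma h1Grad_smul {Ω : Set Plane} (c : ℝ) (f : H1 Ω) (i : Fin 2) :
    h1Grad (c • f) i = c • h1Grad f i := rfl

/-- The space `H¹₀(Ω)`, the closure of `C₀^∞(Ω)` in `H¹(Ω)`. -/
def H10 (Ω : Set Plane) : Submodule ℝ (H1 Ω) :=
  (Submodule.span ℝ {f : H1 Ω |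
    ∃ η, IsTest Ω η ∧ h1Fn f =ᵐ[volume.restrict Ω] η}).topologicalClosure

/-- `G_div`, the closure in `L²(Ω)²` of the divergence free fields in `C₀^∞(Ω)²`. -/
def Gdiv (Ω : Set Plane) : Submodule ℝ (L2Vec Ω) :=
  (Submodule.span ℝ {w : L2Vec Ω | ∃ v : Fin 2 → Plane → ℝ, (∀ i, IsTest Ω (v i)) ∧
    (∀ x, ∑ i, pd i (v i) x = 0) ∧
    ∀ i, w i =ᵐ[volume.restrict Ω] v i}).topologicalClosure

/-- The subspace `{u ∈ H¹₀(Ω)² : div u = 0}` of `H¹(Ω)²`. -/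
def vdivSub (Ω : Set Plane) : Submodule ℝ (PiLp 2 (fun _ : Fin 2 => H1 Ω)) where
  carrier := {u | (∀ j, u j ∈ H10 Ω) ∧ ∑ i, h1Grad (u i) i = 0}
  zero_mem' := by
    refine ⟨fun j => (H10 Ω).zero_mem, ?_⟩
    change ∑ i, h1Grad (0 : H1 Ω) i = 0
    simp [h1Grad_zero]
  add_mem' := by
    rintro u v ⟨hu, hu'⟩ ⟨hv, hv'⟩
    refine ⟨fun j => (H10 Ω).add_mem (hu j) (hv j), ?_⟩
    change ∑ i, h1Grad (u i + v i) i = 0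
    rw [Finset.sum_congr rfl (fun i _ => h1Grad_add (u i) (v i) i), Finset.sum_add_distrib,
      hu', hv', add_zero]
  smul_mem' := by
    rintro c u ⟨hu, hu'⟩
    refine ⟨fun j => (H10 Ω).smul_mem c (hu j), ?_⟩
    change ∑ i, h1Grad (c • u i) i = 0
    rw [Finset.sum_congr rfl (fun i _ => h1Grad_smul c (u i) i), ← Finset.smul_sum, hu', smul_zero]

/-- `V_div = {u ∈ H¹₀(Ω)² : div u = 0}`. It carries the norm of `H¹(Ω)²`, which on a bounded
domain is equivalent to `‖∇u‖`, so the dual space `V_div'` is the usual one. -/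
def Vdiv (Ω : Set Plane) : Type := vdivSub Ω

instance (Ω : Set Plane) : NormedAddCommGroup (Vdiv Ω) :=
  inferInstanceAs (NormedAddCommGroup (vdivSub Ω))

instance (Ω : Set Plane) : InnerProductSpace ℝ (Vdiv Ω) :=
  inferInstanceAs (InnerProductSpace ℝ (vdivSub Ω))

/-- The components of an element of `V_div`. -/
def vFn {Ω : Set Plane} (v : Vdiv Ω) (j : Fin 2) : L2 Ω := h1Fn (v.1 j)

/-- `vPd v i j = ∂ᵢ vⱼ`. -/
def vPd {Ω : Set Plane} (v : Vdiv Ω) (i j : Fin 2) : L2 Ω := h1Grad (v.1 j) i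

/-- The element of `L²(Ω)²` underlying an element of `V_div`. -/
def vL2 {Ω : Set Plane} (v : Vdiv Ω) : L2Vec Ω := WithLp.toLp 2 (vFn v)

/-- The mean value of `f` over `Ω`. -/
def mean {Ω : Set Plane} (f : L2 Ω) : ℝ := ⨍ x in Ω, f x

/-! ### Convolution kernel -/

/-- `a(x) = ∫_Ω J(x - y) dy`. -/
def kerA (Ω : Set Plane) (J : Plane → ℝ) (x : Plane) : ℝ := ∫ y in Ω, J (x - y)

/-- `(J ∗ f)(x) = ∫_Ω J(x - y) f(y) dy`. With `J` replaced by `∂ᵢJ` this is the `i`-th component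
of `∇J ∗ f`, and `kerA` with `J` replaced by `∂ᵢJ` is the `i`-th component of `∇a`. -/
def conv {Ω : Set Plane} (J : Plane → ℝ) (f : L2 Ω) (x : Plane) : ℝ := ∫ y in Ω, J (x - y) * f y

/-- `a^* = sup_{x ∈ Ω} ∫_Ω |J(x - y)| dy`, as an extended number. -/
def aSup (Ω : Set Plane) (J : Plane → ℝ) : ℝ≥0∞ := ⨆ x ∈ Ω, ∫⁻ y in Ω, ‖J (x - y)‖ₑ

/-- `a_* = inf_{x ∈ Ω} ∫_Ω J(x - y) dy`. -/
def aInf (Ω : Set Plane) (J : Plane → ℝ) : ℝ := ⨅ x : Ω, kerA Ω J x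

/-- `b = sup_{x ∈ Ω} ∫_Ω |∇J(x - y)| dy`, as an extended number. -/
def bSup (Ω : Set Plane) (DJ : Fin 2 → Plane → ℝ) : ℝ≥0∞ :=
  ⨆ x ∈ Ω, ∫⁻ y in Ω, ‖(!₂[DJ 0 (x - y), DJ 1 (x - y)] : Plane)‖ₑ

/-- The assumption on the even kernel `J`; `DJ = (∂₁J, ∂₂J)` is its weak gradient. -/
structure KernelAssumption (Ω : Set Plane) (J : Plane → ℝ) (DJ : Fin 2 → Plane → ℝ) : Prop where
  measurable : Measurable J
  measurable_grad : ∀ i, Measurable (DJ i)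
  even : ∀ x, J (-x) = J x
  integrable : ∀ᵐ x ∂(volume.restrict Ω), IntegrableOn (fun y => J (y - x)) Ω
  integrable_grad : ∀ᵐ x ∂(volume.restrict Ω), ∀ i, IntegrableOn (fun y => DJ i (y - x)) Ω
  weakGrad : ∀ᵐ x ∂(volume.restrict Ω),
    IsWeakGrad Ω (fun y => J (y - x)) (fun i y => DJ i (y - x))
  a_nonneg : ∀ᵐ x ∂(volume.restrict Ω), 0 ≤ kerA Ω J x
  aSup_lt_top : aSup Ω J < ⊤
  bSup_lt_top : bSup Ω DJ < ⊤

/-! ### Mobility and potential -/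

/-- `m F''` as a function on `[-1,1]`: the continuous extension of `m F''` from `(-1,1)`. -/
def mobF (m F : ℝ → ℝ) : ℝ → ℝ :=
  extendFrom (Ioo (-1) 1) (fun s => m s * iteratedDeriv 2 F s)

/-- The potential `F`, given on `(-1,1)`, extended to `±1` by its (possibly infinite) limits. -/
def potExt (F : ℝ → ℝ) (s : ℝ) : EReal :=
  limsup (fun r => (F r : EReal)) (𝓝[Ioo (-1) 1] s)

/-- Degenerate mobility: `m ∈ C¹([-1,1])`, `m ≥ 0`, and `m` vanishes exactly at `±1`. -/
structure MobilityAssumption (m : ℝ → ℝ) : Prop where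
  c1 : ContDiffOn ℝ 1 m (Icc (-1) 1)
  nonneg : ∀ s ∈ Icc (-1 : ℝ) 1, 0 ≤ m s
  zero_iff : ∀ s ∈ Icc (-1 : ℝ) 1, m s = 0 ↔ s = -1 ∨ s = 1

/-- `b₂ = min_{[-1,1]} F₂''`. -/
def b2 (F₂ : ℝ → ℝ) : ℝ :=
  ⨅ s : Icc (-1 : ℝ) 1, iteratedDerivWithin 2 F₂ (Icc (-1) 1) s

/-- The assumptions (with degenerate mobility `m`) on the potential `F = F₁ + F₂`, with singular
part `F₁` and regular part `F₂`. -/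
structure PotentialAssumption (Ω : Set Plane) (J : Plane → ℝ) (m F₁ F₂ : ℝ → ℝ) : Prop where
  c2_sing : ContDiffOn ℝ 2 F₁ (Ioo (-1) 1)
  c2_reg : ContDiffOn ℝ 2 F₂ (Icc (-1) 1)
  /-- `m F'' ∈ C([-1,1])` -/
  mob : ∃ g : ℝ → ℝ, ContinuousOn g (Icc (-1) 1) ∧
    EqOn g (fun s => m s * iteratedDeriv 2 (F₁ + F₂) s) (Ioo (-1) 1)
  sing_large : ∃ a₂ > 4 * ((aSup Ω J).toReal - aInf Ω J - b2 F₂), ∃ ε > 0,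
    ∀ s ∈ Ioo (-1 : ℝ) 1, (s ≤ -1 + ε ∨ 1 - ε ≤ s) → a₂ ≤ iteratedDeriv 2 F₁ s
  sing_mono : ∃ ε ∈ Ioc (0 : ℝ) 1, MonotoneOn (iteratedDeriv 2 F₁) (Ico (1 - ε) 1) ∧
    AntitoneOn (iteratedDeriv 2 F₁) (Ioc (-1) (-1 + ε))
  coercive : ∃ c₀ > 0, ∀ᵐ x ∂(volume.restrict Ω), ∀ s ∈ Ioo (-1 : ℝ) 1,
    c₀ ≤ iteratedDeriv 2 (F₁ + F₂) s + kerA Ω J x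

/-! ### Weak solutions -/

/-- `[u, φ]` is a weak solution on `[0,T]`. Here `u`, `φ` are the weakly continuous representatives;
`U`, `Φ` are `u`, `φ` viewed as elements of `L²(0,T;V_div)`, `L²(0,T;V)`, and `u'`, `φ'` are the
distributional time derivatives in `L²(0,T;V_div')`, `L²(0,T;V')`. -/
structure IsWeakSolWith (Ω : Set Plane) (ν : ℝ) (J : Plane → ℝ) (DJ : Fin 2 → Plane → ℝ)
    (m F : ℝ → ℝ) (h : StrongDual ℝ (Vdiv Ω)) (T : ℝ) (u : ℝ → Gdiv Ω) (φ : ℝ → L2 Ω)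
    (U : ℝ → Vdiv Ω) (Φ : ℝ → H1 Ω)
    (u' : ℝ → StrongDual ℝ (Vdiv Ω)) (φ' : ℝ → StrongDual ℝ (H1 Ω)) : Prop where
  u_weakCont : ∀ w : L2Vec Ω, ContinuousOn (fun t => inner ℝ (u t : L2Vec Ω) w) (Icc 0 T)
  φ_weakCont : ∀ w : L2 Ω, ContinuousOn (fun t => inner ℝ (φ t) w) (Icc 0 T)
  u_bdd : ∃ C, ∀ᵐ t ∂(volume.restrict (Ioo 0 T)), ‖u t‖ ≤ C
  φ_bdd : ∃ C, ∀ᵐ t ∂(volume.restrict (Ioo 0 T)), ‖φ t‖ ≤ C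
  u_eq : ∀ᵐ t ∂(volume.restrict (Ioo 0 T)), vL2 (U t) = u t
  φ_eq : ∀ᵐ t ∂(volume.restrict (Ioo 0 T)), h1Fn (Φ t) = φ t
  U_memLp : MemLp U 2 (volume.restrict (Ioo 0 T))
  Φ_memLp : MemLp Φ 2 (volume.restrict (Ioo 0 T))
  u'_memLp : MemLp u' 2 (volume.restrict (Ioo 0 T))
  φ'_memLp : MemLp φ' 2 (volume.restrict (Ioo 0 T))
  u_deriv : ∀ χ : ℝ → ℝ, ContDiff ℝ ∞ χ → HasCompactSupport χ → tsupport χ ⊆ Ioo 0 T →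
    ∀ v : Vdiv Ω, ∫ t in Ioo 0 T, deriv χ t * inner ℝ (u t : L2Vec Ω) (vL2 v)
      = - ∫ t in Ioo 0 T, χ t * u' t v
  φ_deriv : ∀ χ : ℝ → ℝ, ContDiff ℝ ∞ χ → HasCompactSupport χ → tsupport χ ⊆ Ioo 0 T →
    ∀ ψ : H1 Ω, ∫ t in Ioo 0 T, deriv χ t * inner ℝ (φ t) (h1Fn ψ)
      = - ∫ t in Ioo 0 T, χ t * φ' t ψ
  φ_abs_le : ∀ᵐ t ∂(volume.restrict (Ioo 0 T)), ∀ᵐ x ∂(volume.restrict Ω), |φ t x| ≤ 1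
  eq_φ : ∀ ψ : H1 Ω, ∀ᵐ t ∂(volume.restrict (Ioo 0 T)),
    φ' t ψ
      + (∫ x in Ω, ∑ i, mobF m F (φ t x) * h1Grad (Φ t) i x * h1Grad ψ i x)
      + (∫ x in Ω, ∑ i, m (φ t x) * kerA Ω J x * h1Grad (Φ t) i x * h1Grad ψ i x)
      + (∫ x in Ω, ∑ i,
          m (φ t x) * (φ t x * kerA Ω (DJ i) x - conv (DJ i) (φ t) x) * h1Grad ψ i x)
    = ∫ x in Ω, ∑ i, (u t : L2Vec Ω) i x * φ t x * h1Grad ψ i x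
  eq_u : ∀ v : Vdiv Ω, ∀ᵐ t ∂(volume.restrict (Ioo 0 T)),
    u' t v
      + ν * (∫ x in Ω, ∑ i, ∑ j, vPd (U t) i j x * vPd v i j x)
      + (∫ x in Ω, ∑ i, ∑ j, (u t : L2Vec Ω) i x * vPd (U t) i j x * vFn v j x)
    = (∫ x in Ω, ∑ i,
        (kerA Ω J x * φ t x - conv J (φ t) x) * h1Grad (Φ t) i x * vFn v i x) + h v

/-- `[u, φ]` is a weak solution on `[0,T]` (with initial datum `[u 0, φ 0]`). -/
def IsWeakSol (Ω : Set Plane) (ν : ℝ) (J : Plane → ℝ) (DJ : Fin 2 → Plane → ℝ)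
    (m F : ℝ → ℝ) (h : StrongDual ℝ (Vdiv Ω)) (T : ℝ) (u : ℝ → Gdiv Ω) (φ : ℝ → L2 Ω) : Prop :=
  ∃ U Φ u' φ', IsWeakSolWith Ω ν J DJ m F h T u φ U Φ u' φ'

/-! ### Phase space and trajectories -/

/-- `G_div × L²(Ω)` with the metric `d(z₂,z₁) = ‖u₂ - u₁‖ + ‖φ₂ - φ₁‖`. -/
abbrev State (Ω : Set Plane) := WithLp 1 (Gdiv Ω × L2 Ω)

/-- The phase space `X_{m₀} = G_div × Y_{m₀}`, where `Y_{m₀}` is the set of all `φ` with `|φ| ≤ 1`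
a.e., `F(φ) ∈ L¹(Ω)` and mean value in `[-m₀, m₀]`. -/
def phaseSpace (Ω : Set Plane) (F : ℝ → ℝ) (m₀ : ℝ) : Set (State Ω) :=
  {z | (∀ᵐ x ∂(volume.restrict Ω), |z.snd x| ≤ 1) ∧
    ∫⁻ x in Ω, (potExt F (z.snd x)).abs < ⊤ ∧ |mean z.snd| ≤ m₀}

/-- `G_{m₀}`: all global weak solutions with initial datum in `X_{m₀}`, as maps on `[0,∞)`. -/
def weakSolutions (Ω : Set Plane) (ν : ℝ) (J : Plane → ℝ) (DJ : Fin 2 → Plane → ℝ)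
    (m F : ℝ → ℝ) (h : StrongDual ℝ (Vdiv Ω)) (m₀ : ℝ) : Set (ℝ≥0 → State Ω) :=
  {z | z 0 ∈ phaseSpace Ω F m₀ ∧ ∃ (u : ℝ → Gdiv Ω) (φ : ℝ → L2 Ω),
    (∀ T > 0, IsWeakSol Ω ν J DJ m F h T u φ) ∧
    ∀ t : ℝ≥0, (z t).fst = u t ∧ (z t).snd = φ t}

/-- The set `γ^τ(B)` of all points reached at times `≥ τ` from initial data in `B`. -/
def orbitAfter {X : Type*} (G : Set (ℝ≥0 → X)) (τ : ℝ≥0) (B : Set X) : Set X :=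
  {x | ∃ z ∈ G, z 0 ∈ B ∧ ∃ t, τ ≤ t ∧ x = z t}

/-- Eventual boundedness: for every bounded `B` some `γ^τ(B)` is bounded. -/
def EventuallyBounded {X : Type*} [PseudoMetricSpace X] (G : Set (ℝ≥0 → X)) : Prop :=
  ∀ B : Set X, Bornology.IsBounded B → ∃ τ : ℝ≥0, Bornology.IsBounded (orbitAfter G τ B)

/-- Point dissipativity: one bounded set eventually contains every trajectory. -/
def PointDissipative {X : Type*} [PseudoMetricSpace X] (G : Set (ℝ≥0 → X)) : Prop :=
  ∃ B₀ : Set X, Bornology.IsBounded B₀ ∧ ∀ z ∈ G, ∀ᶠ t in atTop, z t ∈ B₀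

end NonlocalCHNS

end

/-! The order parameter costs nothing: `|φ| ≤ 1` bounds `‖φ(t)‖²` by the area of `Ω`, so `‖φ(t) -
mean‖²` is at most four times that area and goes into the constant. What has to be proved is
dissipativity of the velocity, that is, `‖u(t)‖² ≤ ‖u(0)‖² e^{-ηt} + C` (`exists_velocity_bound`).

Formally, one tests the Navier-Stokes equation with `u`. The convective term vanishes. The capillary
force seems to involve the uncontrolled `∇φ`, but `(aφ - J∗φ)∇φ = ∇(aφ²/2 - φ (J∗φ)) + φ (∇J∗φ) -
φ²∇a/2`. The gradient is orthogonal to divergence free fields, and the rest is bounded in terms of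
`sup ∫|∇J|` because `|φ| ≤ 1` (`integral_force_eq`, `integral_force_le`). Young's and Poincaré's
inequalities absorb the force and `h` into the viscous term, leaving `d/dt ‖u‖² ≤ -η‖u‖² + C`
(`exists_dissipation`), and Gronwall's lemma concludes.

Four points need justification. The solution has a time derivative only in `V_div'`, so `d/dt ‖u‖² =
2⟨u', u⟩` is proved by difference quotients in a Gelfand triple (`GelfandPath.energy_identity`). The
products above need a Leibniz rule for bounded functions with weak gradients (`IsWeakGrad.mul`). The
convective term is handled with the embedding of `H¹₀` in `L⁴`. Finally, the equation holds for each
fixed test field outside a null set of times depending on that field, and separability permits the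
time dependent choice `u(t)` (`ae_forall_apply_of_isClosed`). -/

noncomputable section

namespace NonlocalCHNS

/-! ### Evolution in a Gelfand triple -/

/-- A sequence of bump functions at `0` with shrinking supports and bounded ratio of radii. -/
def shrinkingBump (E : Type*) [NormedAddCommGroup E] [NormedSpace ℝ E] [HasContDiffBump E] (n : ℕ) :
    ContDiffBump (0 : E) where
  rIn := 1 / (2 * (n + 1))
  rOut := 1 / (n + 1)
  rIn_pos := by positivity
  rIn_lt_rOut := by
    apply one_div_lt_one_div_of_lt <;> linarith [Nat.cast_nonneg (α := ℝ) n]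

lemma tendsto_rOut_shrinkingBump {E : Type*} [NormedAddCommGroup E] [NormedSpace ℝ E]
    [HasContDiffBump E] : Tendsto (fun n => (shrinkingBump E n).rOut) atTop (𝓝 0) :=
  tendsto_one_div_add_atTop_nhds_zero_nat

/-- With `a = x - t` and `b = x - s` this integral, as a function of `x`, is a smoothed indicator of
`[s, t]`. The four facts make it usable as a cutoff: values in `[0, 1]`, zero outside and one inside
up to a distance `rOut` from the endpoints. -/
lemma intervalIntegral_bump_facts (φ : ContDiffBump (0 : ℝ)) {a b : ℝ} (hab : a ≤ b) :
    (0 ≤ ∫ y in a..b, φ.normed volume y) ∧ (∫ y in a..b, φ.normed volume y) ≤ 1 ∧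
    (b ≤ -φ.rOut ∨ φ.rOut ≤ a → ∫ y in a..b, φ.normed volume y = 0) ∧
    (a ≤ -φ.rOut → φ.rOut ≤ b → ∫ y in a..b, φ.normed volume y = 1) := by
  have h0 : ∀ y, φ.rOut ≤ |y| → φ.normed volume y = 0 := fun y hy => by
    by_contra hne
    have : y ∈ Function.support (φ.normed volume) := hne
    rw [φ.support_normed_eq, Metric.mem_ball, dist_zero_right, Real.norm_eq_abs] at this
    linarith
  refine ⟨intervalIntegral.integral_nonneg hab fun y _ => φ.nonneg_normed y, ?_, ?_, ?_⟩
  · rw [intervalIntegral.integral_of_le hab, ← φ.integral_normed (μ := volume)]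
    exact setIntegral_le_integral φ.integrable_normed (ae_of_all _ φ.nonneg_normed)
  · intro h
    rw [intervalIntegral.integral_congr (g := fun _ => 0), intervalIntegral.integral_zero]
    intro y hy
    rw [uIcc_of_le hab] at hy
    refine h0 y ?_
    rcases h with h | h
    · rw [le_abs]; right; linarith [hy.2]
    · rw [le_abs]; left; linarith [hy.1]
  · intro ha hb
    rw [intervalIntegral.integral_of_le hab, ← φ.integral_normed (μ := volume)]
    refine setIntegral_eq_integral_of_forall_compl_eq_zero fun y hy => h0 y ?_
    rw [le_abs]
    by_contra! hc
    exact hy ⟨by linarith, by linarith⟩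

lemma tendsto_integral_bump_mul {E : Type*} [NormedAddCommGroup E] [NormedSpace ℝ E]
    [FiniteDimensional ℝ E] [MeasurableSpace E] [BorelSpace E] [HasContDiffBump E]
    {μ : Measure E} [μ.IsAddHaarMeasure] {f : E → ℝ} (hf : AEStronglyMeasurable f μ) {x : E}
    (hx : ContinuousAt f x) :
    Tendsto (fun n => ∫ y, (shrinkingBump E n).normed μ (y - x) * f y ∂μ) atTop (𝓝 (f x)) := by
  have := ContDiffBump.convolution_tendsto_right (μ := μ) (φ := shrinkingBump E)
    (g := fun _ => f) (k := fun _ : ℕ => x) tendsto_rOut_shrinkingBump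
    (Eventually.of_forall fun _ => hf) (hx.tendsto.comp tendsto_snd) tendsto_const_nhds
  refine this.congr fun n => ?_
  rw [convolution_eq_swap]
  refine integral_congr_ae (ae_of_all _ fun y => ?_)
  simp only [ContinuousLinearMap.lsmul_apply, smul_eq_mul]
  rw [← neg_sub y x, ContDiffBump.normed_neg]

/-- A continuous function with integrable weak derivative is a primitive of this derivative. -/
lemma sub_eq_intervalIntegral_of_weakDeriv_Ioo {T : ℝ} {f g : ℝ → ℝ}
    (hf : ContinuousOn f (Icc 0 T)) (hg : IntegrableOn g (Ioo 0 T))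
    (h : ∀ χ : ℝ → ℝ, ContDiff ℝ ∞ χ → HasCompactSupport χ → tsupport χ ⊆ Ioo 0 T →
      ∫ t in Ioo 0 T, deriv χ t * f t = - ∫ t in Ioo 0 T, χ t * g t)
    {s t : ℝ} (hs : 0 < s) (hst : s ≤ t) (ht : t < T) : f t - f s = ∫ r in s..t, g r := by
  let ρ : ℕ → ℝ → ℝ := fun n => (shrinkingBump ℝ n).normed volume
  let R : ℕ → ℝ → ℝ := fun n x => ∫ y in (0 : ℝ)..x, ρ n y
  have ρc : ∀ n, Continuous (ρ n) := fun n => (shrinkingBump ℝ n).continuous_normed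
  have Rd : ∀ n x, HasDerivAt (R n) (ρ n x) x := fun n x =>
    intervalIntegral.integral_hasDerivAt_right ((ρc n).intervalIntegrable _ _)
      ((ρc n).stronglyMeasurableAtFilter _ _) (ρc n).continuousAt
  have Rs : ∀ n, ContDiff ℝ ∞ (R n) := fun n => by
    rw [contDiff_infty_iff_deriv]
    refine ⟨fun x => (Rd n x).differentiableAt, ?_⟩
    rw [show deriv (R n) = ρ n from funext fun x => (Rd n x).deriv]
    exact (shrinkingBump ℝ n).contDiff_normed
  -- `χ n` smooths the indicator of `[s, t]` and its derivative is a bump at `s` minus a bump at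
  -- `t`. Testing with it gives `f s - f t` on the left and `-∫ g` over `[s, t]` on the right as `n
  -- → ∞`.
  let χ : ℕ → ℝ → ℝ := fun n x => R n (x - s) - R n (x - t)
  have χs : ∀ n, ContDiff ℝ ∞ (χ n) := fun n =>
    ((Rs n).comp (contDiff_id.sub contDiff_const)).sub
      ((Rs n).comp (contDiff_id.sub contDiff_const))
  have χd : ∀ n x, deriv (χ n) x = ρ n (x - s) - ρ n (x - t) := fun n x =>
    (((Rd n (x - s)).comp_sub_const x s).sub ((Rd n (x - t)).comp_sub_const x t)).deriv
  have χe : ∀ n x, χ n x = ∫ y in (x - t)..(x - s), ρ n y := fun n x =>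
    intervalIntegral.integral_interval_sub_left ((ρc n).intervalIntegrable _ _)
      ((ρc n).intervalIntegrable _ _)
  have facts := fun n x => intervalIntegral_bump_facts (shrinkingBump ℝ n)
    (show x - t ≤ x - s by linarith)
  have hsub : ∀ n, tsupport (χ n) ⊆ Icc (s - (shrinkingBump ℝ n).rOut)
      (t + (shrinkingBump ℝ n).rOut) := fun n => by
    refine closure_minimal (fun x hx => ?_) isClosed_Icc
    by_contra hc
    refine hx ((χe n x).trans ((facts n x).2.2.1 ?_))
    rw [mem_Icc, not_and_or] at hc
    rcases hc with hc | hc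
    · left; linarith
    · right; linarith
  have hr : Tendsto (fun n => (shrinkingBump ℝ n).rOut) atTop (𝓝 0) :=
    tendsto_rOut_shrinkingBump
  have hev : ∀ᶠ n in atTop, tsupport (χ n) ⊆ Ioo 0 T := by
    filter_upwards [hr.eventually_lt_const hs, hr.eventually_lt_const (sub_pos.2 ht)]
      with n h1 h2
    exact (hsub n).trans fun x hx => ⟨by linarith [hx.1], by linarith [hx.2]⟩
  have hid : ∀ᶠ n in atTop, ∫ x in Ioo 0 T, deriv (χ n) x * f x
      = - ∫ x in Ioo 0 T, χ n x * g x := by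
    filter_upwards [hev] with n hn
    exact h _ (χs n) (HasCompactSupport.of_support_subset_isCompact isCompact_Icc
      (subset_closure.trans (hsub n))) hn
  have fm : AEStronglyMeasurable ((Ioo 0 T).indicator f) volume :=
    (aestronglyMeasurable_indicator_iff measurableSet_Ioo).2
      ((hf.mono Ioo_subset_Icc_self).aestronglyMeasurable measurableSet_Ioo)
  have key : ∀ x ∈ Ioo 0 T, Tendsto (fun n => ∫ y in Ioo 0 T, ρ n (y - x) * f y) atTop
      (𝓝 (f x)) := fun x hx => by
    have hnb : Ioo 0 T ∈ 𝓝 x := isOpen_Ioo.mem_nhds hx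
    have hc : ContinuousAt ((Ioo 0 T).indicator f) x :=
      (hf.continuousAt (mem_of_superset hnb Ioo_subset_Icc_self)).congr
        (by filter_upwards [hnb] with y hy using (indicator_of_mem hy f).symm)
    have := tendsto_integral_bump_mul fm hc
    rw [indicator_of_mem hx] at this
    refine this.congr fun n => ?_
    rw [← integral_indicator measurableSet_Ioo]
    congr 1
    ext y
    by_cases hy : y ∈ Ioo 0 T <;> simp [hy, ρ]
  have ρi : ∀ n x, IntegrableOn (fun y => ρ n (y - x) * f y) (Ioo 0 T) := fun n x =>
    (ContinuousOn.integrableOn_compact isCompact_Icc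
      (((ρc n).comp (continuous_id.sub continuous_const)).continuousOn.mul hf)).mono_set
      Ioo_subset_Icc_self
  have lim1 : Tendsto (fun n => ∫ x in Ioo 0 T, deriv (χ n) x * f x) atTop (𝓝 (f s - f t)) := by
    refine ((key s ⟨hs, hst.trans_lt ht⟩).sub (key t ⟨hs.trans_le hst, ht⟩)).congr fun n => ?_
    rw [← integral_sub (ρi n s) (ρi n t)]
    simp only [χd, sub_mul]
  have lim2 : Tendsto (fun n => ∫ x in Ioo 0 T, χ n x * g x) atTop
      (𝓝 (∫ x in Ioo 0 T, (Ioc s t).indicator g x)) := by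
    refine tendsto_integral_of_dominated_convergence (fun x => ‖g x‖)
      (fun n => ((χs n).continuous.aestronglyMeasurable).mul hg.aestronglyMeasurable) hg.norm
      (fun n => ae_of_all _ fun x => ?_) ?_
    · rw [norm_mul, χe]
      refine mul_le_of_le_one_left (norm_nonneg _) ?_
      rw [Real.norm_of_nonneg (facts n x).1]
      exact (facts n x).2.1
    -- At the two endpoints half of the bump's mass may be cut off, so the limit of `χ n` can differ
    -- from the indicator there.
    · have hne : ∀ᵐ x ∂(volume.restrict (Ioo 0 T)), x ≠ s ∧ x ≠ t := by
        refine ae_restrict_of_ae ?_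
        filter_upwards [compl_mem_ae_iff.2 (measure_singleton (μ := volume) s),
          compl_mem_ae_iff.2 (measure_singleton (μ := volume) t)] with x h1 h2 using ⟨h1, h2⟩
      filter_upwards [hne] with x ⟨hxs, hxt⟩
      refine tendsto_nhds_of_eventually_eq ?_
      by_cases hx : x ∈ Ioc s t
      · have h1 : s < x := hx.1
        have h2 : x < t := lt_of_le_of_ne hx.2 hxt
        filter_upwards [hr.eventually_lt_const (sub_pos.2 h1),
          hr.eventually_lt_const (sub_pos.2 h2)] with n h3 h4
        rw [indicator_of_mem hx, χe, (facts n x).2.2.2 (by linarith) (by linarith), one_mul]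
      · rw [indicator_of_notMem hx]
        rw [mem_Ioc, not_and_or, not_lt, not_le] at hx
        rcases hx with hx | hx
        · have h1 : x < s := lt_of_le_of_ne hx hxs
          filter_upwards [hr.eventually_lt_const (sub_pos.2 h1)] with n h3
          rw [χe, (facts n x).2.2.1 (by left; linarith), zero_mul]
        · filter_upwards [hr.eventually_lt_const (sub_pos.2 hx)] with n h3
          rw [χe, (facts n x).2.2.1 (by right; linarith), zero_mul]
  have := tendsto_nhds_unique lim1 (lim2.neg.congr' (hid.mono fun n hn => hn.symm))
  have hin : Ioc s t ⊆ Ioo 0 T := fun x hx => ⟨hs.trans hx.1, hx.2.trans_lt ht⟩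
  rw [setIntegral_indicator measurableSet_Ioc, inter_eq_right.2 hin, ← intervalIntegral.integral_of_le hst] at this
  linarith

/-- The function minus the primitive is constant on the open interval; continuity carries this to
the endpoints, so the initial time is included. -/
lemma sub_eq_intervalIntegral_of_weakDeriv {T : ℝ} {f g : ℝ → ℝ}
    (hf : ContinuousOn f (Icc 0 T)) (hg : Integrable g)
    (h : ∀ χ : ℝ → ℝ, ContDiff ℝ ∞ χ → HasCompactSupport χ → tsupport χ ⊆ Ioo 0 T →
      ∫ t in Ioo 0 T, deriv χ t * f t = - ∫ t in Ioo 0 T, χ t * g t)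
    {s t : ℝ} (hs : s ∈ Icc 0 T) (ht : t ∈ Icc 0 T) : f t - f s = ∫ r in s..t, g r := by
  rcases eq_or_ne T 0 with hT | hT
  · have h1 : s = 0 := le_antisymm (hs.2.trans hT.le) hs.1
    have h2 : t = 0 := le_antisymm (ht.2.trans hT.le) ht.1
    simp [h1, h2]
  have hT : 0 < T := lt_of_le_of_ne (hs.1.trans hs.2) hT.symm
  set P : ℝ → ℝ := fun x => ∫ r in (0 : ℝ)..x, g r with hP
  have Pc : Continuous P := hg.continuous_primitive 0
  have hii : ∀ a b, IntervalIntegrable g volume a b := fun a b => hg.intervalIntegrable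
  have Ps : ∀ a b, P b - P a = ∫ r in a..b, g r := fun a b =>
    intervalIntegral.integral_interval_sub_left (hii _ _) (hii _ _)
  have h1 : ∀ x ∈ Ioo 0 T, f x - P x = f (T / 2) - P (T / 2) := fun x hx => by
    rcases le_total x (T / 2) with hle | hle
    · have := sub_eq_intervalIntegral_of_weakDeriv_Ioo hf hg.integrableOn h hx.1 hle (by linarith)
      rw [← Ps] at this; linarith
    · have := sub_eq_intervalIntegral_of_weakDeriv_Ioo hf hg.integrableOn h
        (by linarith : 0 < T / 2) hle hx.2
      rw [← Ps] at this; linarith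
  have h2 : EqOn (fun x => f x - P x) (fun _ => f (T / 2) - P (T / 2)) (Icc 0 T) := by
    refine EqOn.of_subset_closure (s := Ioo 0 T) h1 (hf.sub Pc.continuousOn) continuousOn_const
      Ioo_subset_Icc_self ?_
    rw [closure_Ioo hT.ne]
  have e1 := h2 hs
  have e2 := h2 ht
  rw [← Ps]
  simp only at e1 e2
  linarith

/-- Translation is continuous on `Lᵖ(ℝ; V)`. -/
lemma continuous_translate_Lp {V : Type*} [NormedAddCommGroup V]
    (X : Lp V 2 (volume : Measure ℝ)) :
    Continuous fun α : ℝ => Lp.compMeasurePreserving (fun s : ℝ => s + α)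
      (measurePreserving_add_right volume α) X := by
  let g : C(ℝ, C(ℝ, ℝ)) := (ContinuousMap.mk (fun a : ℝ × ℝ => a.2 + a.1)
    (continuous_snd.add continuous_fst)).curry
  exact Continuous.compMeasurePreservingLp (f := fun _ => X) (g := g) continuous_const g.continuous
    (fun α => measurePreserving_add_right volume α) (by simp)

/-! ### The energy identity in a Gelfand triple. -/

section Triple

variable {V : Type*} [NormedAddCommGroup V] [NormedSpace ℝ V]

/-- Translations are continuous on `L²` and the duality pairing is bounded bilinear. This is what
lets the shift `δ` tend to zero in the difference quotients of `‖u‖²`. -/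
lemma continuous_integral_translate (W : Lp (StrongDual ℝ V) 2 (volume : Measure ℝ))
    (X : Lp V 2 (volume : Measure ℝ)) (S : Set ℝ) :
    Continuous fun p : ℝ × ℝ => ∫ s in S, W (s + p.1) (X (s + p.2)) := by
  let B := (ContinuousLinearMap.id ℝ (StrongDual ℝ V)).lpPairing (volume.restrict S) 2 2
  have hc : Continuous fun p : ℝ × ℝ =>
      B (LpToLpRestrictCLM ℝ (StrongDual ℝ V) ℝ volume 2 S
          (Lp.compMeasurePreserving (fun s : ℝ => s + p.1)
            (measurePreserving_add_right volume p.1) W))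
        (LpToLpRestrictCLM ℝ V ℝ volume 2 S
          (Lp.compMeasurePreserving (fun s : ℝ => s + p.2)
            (measurePreserving_add_right volume p.2) X)) :=
    (B.continuous.comp ((ContinuousLinearMap.continuous _).comp
      ((continuous_translate_Lp W).comp continuous_fst))).clm_apply
      ((ContinuousLinearMap.continuous _).comp ((continuous_translate_Lp X).comp continuous_snd))
  refine hc.congr fun p => ?_
  rw [ContinuousLinearMap.lpPairing_eq_integral]
  refine integral_congr_ae ?_
  filter_upwards [LpToLpRestrictCLM_coeFn ℝ S (Lp.compMeasurePreserving (fun s : ℝ => s + p.1)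
      (measurePreserving_add_right volume p.1) W),
    LpToLpRestrictCLM_coeFn ℝ S (Lp.compMeasurePreserving (fun s : ℝ => s + p.2)
      (measurePreserving_add_right volume p.2) X),
    ae_restrict_of_ae (Lp.coeFn_compMeasurePreserving W (measurePreserving_add_right volume p.1)),
    ae_restrict_of_ae (Lp.coeFn_compMeasurePreserving X (measurePreserving_add_right volume p.2))]
    with s h1 h2 h3 h4
  rw [h1, h2, h3, h4]
  rfl

lemma integrable_dual_pairing {α : Type*} [MeasurableSpace α] {μ : Measure α}
    {W : α → StrongDual ℝ V} {X : α → V} (hW : MemLp W 2 μ) (hX : MemLp X 2 μ) :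
    Integrable (fun s => W s (X s)) μ :=
  memLp_one_iff_integrable.1
    ((ContinuousLinearMap.id ℝ (StrongDual ℝ V)).memLp_of_bilin (r := 1) hW hX)

lemma sq_norm_integrable {α E : Type*} [NormedAddCommGroup E] [MeasurableSpace α] {μ : Measure α}
    {X : α → E} (hX : MemLp X 2 μ) : Integrable (fun s => ‖X s‖ ^ 2) μ :=
  hX.integrable_norm_pow (by norm_num)

/-- Needed for Fubini in `difference_quotient`. By translation invariance the integral over `s` is
bounded by `‖W‖² + ‖X‖²` (norms in `L²`), uniformly in `θ`. -/
lemma integrable_prod_pairing {W : ℝ → StrongDual ℝ V} {X : ℝ → V}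
    (hWm : StronglyMeasurable W) (hXm : StronglyMeasurable X)
    (hW : MemLp W 2 volume) (hX : MemLp X 2 volume) (σ τ δ β : ℝ) :
    Integrable (fun p : ℝ × ℝ => W (p.1 + p.2 * δ) (X (p.1 + β)))
      ((volume.restrict (Ioc σ τ)).prod (volume.restrict (Ioc 0 1))) := by
  have hm : StronglyMeasurable fun p : ℝ × ℝ => W (p.1 + p.2 * δ) (X (p.1 + β)) :=
    (isBoundedBilinearMap_apply.continuous).comp_stronglyMeasurable
      ((hWm.comp_measurable (by fun_prop : Measurable fun p : ℝ × ℝ => p.1 + p.2 * δ)).prodMk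
        (hXm.comp_measurable (by fun_prop : Measurable fun p : ℝ × ℝ => p.1 + β)))
  have tW : ∀ α, MemLp (fun s => W (s + α)) 2 volume := fun α =>
    hW.comp_measurePreserving (measurePreserving_add_right volume α)
  have tX : MemLp (fun s => X (s + β)) 2 volume :=
    hX.comp_measurePreserving (measurePreserving_add_right volume β)
  rw [integrable_prod_iff' hm.aestronglyMeasurable]
  refine ⟨ae_of_all _ fun θ => (integrable_dual_pairing (tW (θ * δ)) tX).restrict, ?_⟩
  refine Integrable.mono' (g := fun _ => (∫ s, ‖W s‖ ^ 2) + ∫ s, ‖X s‖ ^ 2) (by simp)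
    (StronglyMeasurable.aestronglyMeasurable
      (StronglyMeasurable.integral_prod_left' (f := fun p : ℝ × ℝ =>
        ‖W (p.1 + p.2 * δ) (X (p.1 + β))‖) hm.norm)) (ae_of_all _ fun θ => ?_)
  rw [Real.norm_of_nonneg (integral_nonneg fun _ => norm_nonneg _)]
  calc ∫ s in Ioc σ τ, ‖W (s + θ * δ) (X (s + β))‖
      ≤ ∫ s, ‖W (s + θ * δ) (X (s + β))‖ := setIntegral_le_integral
        (integrable_dual_pairing (tW _) tX).norm (ae_of_all _ fun _ => norm_nonneg _)
    _ ≤ ∫ s, (‖W (s + θ * δ)‖ ^ 2 + ‖X (s + β)‖ ^ 2) := by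
        refine integral_mono (integrable_dual_pairing (tW _) tX).norm
          ((sq_norm_integrable (tW _)).add (sq_norm_integrable tX)) fun s => ?_
        refine ((W (s + θ * δ)).le_opNorm _).trans ?_
        nlinarith [sq_nonneg (‖W (s + θ * δ)‖ - ‖X (s + β)‖), sq_nonneg ‖W (s + θ * δ)‖,
          sq_nonneg ‖X (s + β)‖]
    _ = _ := by
        rw [integral_add (sq_norm_integrable (tW _)) (sq_norm_integrable tX),
          integral_add_right_eq_self (fun s => ‖W s‖ ^ 2),
          integral_add_right_eq_self (fun s => ‖X s‖ ^ 2)]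

variable {H : Type*} [NormedAddCommGroup H] [InnerProductSpace ℝ H]

/-- Data of a function in `L²(V)` with time derivative in `L²(V')`: `u` is the weakly continuous
representative, `X` and `W` are the function and its derivative, extended to `ℝ`. -/
structure GelfandPath (ι : V →L[ℝ] H) (T : ℝ) (u : ℝ → H) (X : ℝ → V)
    (W : ℝ → StrongDual ℝ V) : Prop where
  weakCont : ∀ w : H, ContinuousOn (fun t => inner ℝ (u t) w) (Icc 0 T)
  measX : StronglyMeasurable X
  measW : StronglyMeasurable W
  memX : MemLp X 2 volume
  memW : MemLp W 2 volume
  eq : ∀ᵐ t, t ∈ Ioo 0 T → ι (X t) = u t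
  ftc : ∀ v : V, ∀ s ∈ Icc 0 T, ∀ t ∈ Icc 0 T,
    inner ℝ (u t) (ι v) - inner ℝ (u s) (ι v) = ∫ r in s..t, W r v

namespace GelfandPath

variable {ι : V →L[ℝ] H} {T : ℝ} {u : ℝ → H} {X : ℝ → V} {W : ℝ → StrongDual ℝ V}

lemma tendsto_average_right {f : ℝ → ℝ} (hf : ContinuousOn f (Icc 0 T)) {τ : ℝ}
    (hτ : τ ∈ Ico 0 T) :
    Tendsto (fun z => (z - τ)⁻¹ * ∫ s in τ..z, f s) (𝓝[>] τ) (𝓝 (f τ)) := by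
  have hnb : Icc 0 T ∈ 𝓝[>] τ :=
    mem_of_superset (Ioo_mem_nhdsGT hτ.2) fun x hx => ⟨hτ.1.trans hx.1.le, hx.2.le⟩
  have hd : HasDerivWithinAt (fun u => ∫ x in τ..u, f x) (f τ) (Ici τ) τ := by
    refine intervalIntegral.integral_hasDerivWithinAt_right (t := Ioi τ) (by simp) ?_ ?_
    · exact ⟨Icc 0 T, hnb, hf.aestronglyMeasurable measurableSet_Icc⟩
    · exact (hf τ ⟨hτ.1, hτ.2.le⟩).mono_of_mem_nhdsWithin hnb
  have := (hasDerivWithinAt_iff_tendsto_slope' self_notMem_Ioi).1 hd.Ioi_of_Ici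
  refine this.congr fun z => ?_
  simp [slope_def_field, div_eq_inv_mul]

lemma tendsto_average_const {f : ℝ → ℝ} (hf : ContinuousOn f (Icc 0 T)) {τ : ℝ}
    (hτ : τ ∈ Ico 0 T) :
    Tendsto (fun δ => δ⁻¹ * ∫ s in τ..τ + δ, f s) (𝓝[>] 0) (𝓝 (f τ)) := by
  have h2 : Tendsto (fun δ : ℝ => τ + δ) (𝓝[>] 0) (𝓝[>] τ) := by
    refine tendsto_nhdsWithin_iff.2 ⟨?_, eventually_mem_nhdsWithin.mono fun δ hδ => ?_⟩
    · have : Tendsto (fun δ : ℝ => τ + δ) (𝓝 0) (𝓝 (τ + 0)) :=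
        (continuous_const.add continuous_id).tendsto 0
      rw [add_zero] at this
      exact this.mono_left nhdsWithin_le_nhds
    · exact lt_add_of_pos_right τ hδ
  refine ((tendsto_average_right hf hτ).comp h2).congr fun δ => ?_
  simp

lemma integrable_sq (h : GelfandPath ι T u X W) : Integrable fun s => ‖ι (X s)‖ ^ 2 :=
  sq_norm_integrable (ι.comp_memLp' h.memX)

lemma ftc' (h : GelfandPath ι T u X W) (v : V) {s t : ℝ} (hs : s ∈ Icc 0 T) (ht : t ∈ Icc 0 T) :
    inner ℝ (u t - u s) (ι v) = ∫ r in s..t, W r v := by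
  rw [inner_sub_left, h.ftc v s hs t ht]

/-- Weak continuity alone would not give this. Replace `‖u s‖²` by `(u s, u τ)`, which is continuous
in `s`. The error is the integral of `⟨W r, X s⟩` for `r` in `(τ, s)`, and its average over `s` is
at most half the integral of `‖W‖² + ‖X‖²` over `(τ, τ + δ)`, which vanishes with `δ`. -/
lemma tendsto_average_sq (h : GelfandPath ι T u X W) {τ : ℝ} (hτ : τ ∈ Ico 0 T) :
    Tendsto (fun δ => δ⁻¹ * ∫ s in τ..τ + δ, ‖ι (X s)‖ ^ 2) (𝓝[>] 0) (𝓝 (‖u τ‖ ^ 2)) := by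
  have iW := sq_norm_integrable h.memW
  have iX := sq_norm_integrable h.memX
  have hin : ContinuousOn (fun s => inner ℝ (u s) (u τ)) (Icc 0 T) := h.weakCont (u τ)
  have l1 := tendsto_average_const hin hτ
  rw [real_inner_self_eq_norm_sq] at l1
  have l2 : Tendsto (fun δ => ((∫ s in τ..τ + δ, ‖W s‖ ^ 2) + ∫ s in τ..τ + δ, ‖X s‖ ^ 2) / 2)
      (𝓝[>] 0) (𝓝 0) := by
    have hc : Continuous fun δ =>
        ((∫ s in τ..τ + δ, ‖W s‖ ^ 2) + ∫ s in τ..τ + δ, ‖X s‖ ^ 2) / 2 := by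
      have c1 := (iW.continuous_primitive τ).comp (continuous_const.add continuous_id :
        Continuous fun δ : ℝ => τ + δ)
      have c2 := (iX.continuous_primitive τ).comp (continuous_const.add continuous_id :
        Continuous fun δ : ℝ => τ + δ)
      exact (c1.add c2).div_const 2
    have := hc.tendsto 0
    simp only [add_zero, intervalIntegral.integral_same, zero_div] at this
    exact this.mono_left nhdsWithin_le_nhds
  have l3 : Tendsto (fun δ => δ⁻¹ * (∫ s in τ..τ + δ, ‖ι (X s)‖ ^ 2)
      - δ⁻¹ * ∫ s in τ..τ + δ, inner ℝ (u s) (u τ)) (𝓝[>] 0) (𝓝 0) := by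
    refine squeeze_zero_norm' ?_ l2
    filter_upwards [Ioo_mem_nhdsGT (sub_pos.2 hτ.2)] with δ ⟨hδ, hδT⟩
    have hle : τ ≤ τ + δ := by linarith
    have hsub : Icc τ (τ + δ) ⊆ Icc 0 T := fun x hx => ⟨hτ.1.trans hx.1, by linarith [hx.2]⟩
    have i1 : IntervalIntegrable (fun s => inner ℝ (u s) (u τ)) volume τ (τ + δ) :=
      (hin.mono hsub).intervalIntegrable_of_Icc hle
    rw [← mul_sub, ← intervalIntegral.integral_sub h.integrable_sq.intervalIntegrable i1,
      norm_mul, norm_inv, Real.norm_of_nonneg hδ.le, inv_mul_le_iff₀ hδ]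
    set A := ∫ s in τ..τ + δ, ‖W s‖ ^ 2
    have hA : A = ∫ s in Ioc τ (τ + δ), ‖W s‖ ^ 2 := intervalIntegral.integral_of_le hle
    have hb : ∀ᵐ s, s ∈ Ioc τ (τ + δ) →
        ‖‖ι (X s)‖ ^ 2 - inner ℝ (u s) (u τ)‖ ≤ (A + δ * ‖X s‖ ^ 2) / 2 := by
      filter_upwards [h.eq] with s hs hsm
      have hsT : s ∈ Ioo 0 T := ⟨hτ.1.trans_lt hsm.1, by linarith [hsm.2]⟩
      rw [hs hsT, ← real_inner_self_eq_norm_sq, real_inner_comm (u τ) (u s), ← inner_sub_left]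
      nth_rw 2 [← hs hsT]
      -- For fixed `s` the vector `X s` is an admissible constant test vector, which is why one copy
      -- of `u s` was kept in the form `ι (X s)`.
      rw [h.ftc' (X s) ⟨hτ.1, hτ.2.le⟩ ⟨hsT.1.le, hsT.2.le⟩,
        intervalIntegral.integral_of_le hsm.1.le]
      calc ‖∫ r in Ioc τ s, W r (X s)‖
          ≤ ∫ r in Ioc τ s, (‖W r‖ ^ 2 + ‖X s‖ ^ 2) / 2 := by
            refine norm_integral_le_of_norm_le
              ((iW.integrableOn.add (integrable_const _)).div_const 2)
              (ae_of_all _ fun r => ((W r).le_opNorm _).trans ?_)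
            nlinarith [sq_nonneg (‖W r‖ - ‖X s‖)]
        _ ≤ ∫ r in Ioc τ (τ + δ), (‖W r‖ ^ 2 + ‖X s‖ ^ 2) / 2 := by
            refine setIntegral_mono_set ((iW.integrableOn.add (integrable_const _)).div_const 2)
              (ae_of_all _ fun r => by dsimp; positivity)
              (Ioc_subset_Ioc_right hsm.2).eventuallyLE
        _ = (A + δ * ‖X s‖ ^ 2) / 2 := by
            rw [integral_div, integral_add iW.integrableOn (integrable_const _), ← hA]
            simp [hδ.le]
    refine (intervalIntegral.norm_integral_le_of_norm_le hle hb
      ((((continuous_const.intervalIntegrable _ _)).add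
        (iX.intervalIntegrable.const_mul δ)).div_const 2)).trans_eq ?_
    rw [intervalIntegral.integral_div, intervalIntegral.integral_add
      (continuous_const.intervalIntegrable _ _) (iX.intervalIntegrable.const_mul δ),
      intervalIntegral.integral_const_mul, intervalIntegral.integral_const]
    simp only [add_sub_cancel_left, smul_eq_mul]
    ring
  have := l3.add l1
  simpa using this

/-- The left side telescopes to the integral over `(σ, τ)` of `(‖u(s+δ)‖² - ‖u(s)‖²)/δ`. The
increment is `(u(s+δ) - u(s), u(s+δ) + u(s))`, hence the integral of `⟨W r, X(s+δ) + X(s)⟩` over `r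
= s + θδ`, and Fubini moves `θ` outside. The form `s + 0` makes both terms instances of the same
translated pairing. -/
lemma difference_quotient (h : GelfandPath ι T u X W) {σ τ δ : ℝ} (hσ : 0 ≤ σ) (hστ : σ ≤ τ)
    (hδ : 0 < δ) (hτ : τ + δ < T) :
    δ⁻¹ * (∫ s in τ..τ + δ, ‖ι (X s)‖ ^ 2) - δ⁻¹ * ∫ s in σ..σ + δ, ‖ι (X s)‖ ^ 2
      = ∫ θ in (0 : ℝ)..1, ((∫ s in Ioc σ τ, W (s + θ * δ) (X (s + δ)))
          + ∫ s in Ioc σ τ, W (s + θ * δ) (X (s + 0))) := by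
  have hi : ∀ a b, IntervalIntegrable (fun s => ‖ι (X s)‖ ^ 2) volume a b :=
    fun a b => h.integrable_sq.intervalIntegrable
  have hi' : ∀ a b, IntervalIntegrable (fun s => ‖ι (X (s + δ))‖ ^ 2) volume a b :=
    fun a b => (h.integrable_sq.comp_add_right δ).intervalIntegrable
  have e1 : (∫ s in τ..τ + δ, ‖ι (X s)‖ ^ 2) - (∫ s in σ..σ + δ, ‖ι (X s)‖ ^ 2)
      = ∫ s in σ..τ, (‖ι (X (s + δ))‖ ^ 2 - ‖ι (X s)‖ ^ 2) := by
    rw [intervalIntegral.integral_sub (hi' _ _) (hi _ _),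
      intervalIntegral.integral_comp_add_right (fun s => ‖ι (X s)‖ ^ 2) δ,
      intervalIntegral.integral_interval_sub_interval_comm (hi _ _) (hi _ _) (hi _ _),
      intervalIntegral.integral_symm σ τ, intervalIntegral.integral_symm (σ + δ) (τ + δ)]
    ring
  have hq : ∀ᵐ s, s + δ ∈ Ioo 0 T → ι (X (s + δ)) = u (s + δ) :=
    (measurePreserving_add_right volume δ).quasiMeasurePreserving.ae h.eq
  have e2 : ∀ᵐ s, s ∈ Ioc σ τ → δ⁻¹ * (‖ι (X (s + δ))‖ ^ 2 - ‖ι (X s)‖ ^ 2)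
      = ∫ θ in (0 : ℝ)..1, (W (s + θ * δ) (X (s + δ)) + W (s + θ * δ) (X (s + 0))) := by
    filter_upwards [h.eq, hq] with s h1 h2 hs
    have m1 : s ∈ Ioo 0 T := ⟨hσ.trans_lt hs.1, by linarith [hs.2]⟩
    have m2 : s + δ ∈ Ioo 0 T := ⟨by linarith [m1.1], by linarith [hs.2]⟩
    have e3 : ‖ι (X (s + δ))‖ ^ 2 - ‖ι (X s)‖ ^ 2
        = inner ℝ (u (s + δ) - u s) (ι (X (s + δ) + X s)) := by
      rw [map_add, h1 m1, h2 m2, inner_add_right, inner_sub_left, inner_sub_left,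
        real_inner_self_eq_norm_sq, real_inner_self_eq_norm_sq, real_inner_comm (u s)]
      ring
    rw [e3, h.ftc' _ ⟨m1.1.le, m1.2.le⟩ ⟨m2.1.le, m2.2.le⟩]
    have := intervalIntegral.integral_comp_mul_add (a := 0) (b := 1)
      (fun r => W r (X (s + δ) + X s)) hδ.ne' s
    simp only [mul_zero, zero_add, mul_one] at this
    rw [add_comm s δ] at this ⊢
    rw [smul_eq_mul] at this
    rw [← this]
    simp only [map_add, add_zero]
    refine intervalIntegral.integral_congr fun θ _ => ?_
    rw [mul_comm δ θ, add_comm (θ * δ) s]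
  have p1 := integrable_prod_pairing h.measW h.measX h.memW h.memX σ τ δ δ
  have p2 := integrable_prod_pairing h.measW h.measX h.memW h.memX σ τ δ 0
  rw [← mul_sub, e1, ← intervalIntegral.integral_const_mul,
    intervalIntegral.integral_of_le hστ]
  rw [setIntegral_congr_ae measurableSet_Ioc e2]
  simp only [intervalIntegral.integral_of_le zero_le_one]
  rw [integral_integral_swap (f := fun s θ => W (s + θ * δ) (X (s + δ))
    + W (s + θ * δ) (X (s + 0))) (p1.add p2)]
  refine integral_congr_ae ?_
  filter_upwards [p1.prod_left_ae, p2.prod_left_ae] with θ a1 a2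
  exact integral_add a1 a2

/-- The energy identity `‖u(τ)‖² - ‖u(σ)‖² = 2 ∫ ⟨u', u⟩`. -/
theorem energy_identity (h : GelfandPath ι T u X W) {σ τ : ℝ} (hσ : 0 ≤ σ) (hστ : σ ≤ τ)
    (hτ : τ < T) : ‖u τ‖ ^ 2 - ‖u σ‖ ^ 2 = 2 * ∫ s in σ..τ, W s (X s) := by
  have l1 := (h.tendsto_average_sq ⟨hσ.trans hστ, hτ⟩).sub
    (h.tendsto_average_sq ⟨hσ, hστ.trans_lt hτ⟩)
  have hG := continuous_integral_translate (h.memW.toLp W) (h.memX.toLp X) (Ioc σ τ)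
  have hGe : ∀ α β, ∫ s in Ioc σ τ, (h.memW.toLp W) (s + α) ((h.memX.toLp X) (s + β))
      = ∫ s in Ioc σ τ, W (s + α) (X (s + β)) := fun α β => by
    refine integral_congr_ae (ae_restrict_of_ae ?_)
    filter_upwards [(measurePreserving_add_right volume α).quasiMeasurePreserving.ae
        h.memW.coeFn_toLp,
      (measurePreserving_add_right volume β).quasiMeasurePreserving.ae
        h.memX.coeFn_toLp] with s h1 h2
    rw [h1, h2]
  simp only [hGe] at hG
  -- The right side of `difference_quotient` extends continuously to `δ = 0`, with the value `2 ∫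
  -- ⟨W, X⟩`; the left side tends to `‖u τ‖² - ‖u σ‖²`.
  have c : Continuous fun δ : ℝ => ∫ θ in (0 : ℝ)..1,
      ((∫ s in Ioc σ τ, W (s + θ * δ) (X (s + δ)))
        + ∫ s in Ioc σ τ, W (s + θ * δ) (X (s + 0))) := by
    refine intervalIntegral.continuous_parametric_intervalIntegral_of_continuous' ?_ 0 1
    refine Continuous.add (hG.comp (g := fun p : ℝ × ℝ => _)
      (f := fun p : ℝ × ℝ => (p.2 * p.1, p.1)) (by fun_prop))
      (hG.comp (g := fun p : ℝ × ℝ => _) (f := fun p : ℝ × ℝ => (p.2 * p.1, 0)) (by fun_prop))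
  have l2 := (c.tendsto 0).mono_left (nhdsWithin_le_nhds (s := Ioi 0))
  have l3 := tendsto_nhds_unique (l1.congr' ?_) l2
  · rw [l3]
    simp only [mul_zero, add_zero, intervalIntegral.integral_const, sub_zero, one_smul]
    rw [intervalIntegral.integral_of_le hστ]
    ring
  · filter_upwards [Ioo_mem_nhdsGT (sub_pos.2 hτ)] with δ ⟨hδ, hδT⟩
    exact h.difference_quotient hσ hστ hδ (by linarith)

/-- Exponential decay up to a constant from a differential inequality. -/
theorem norm_sq_le (h : GelfandPath ι T u X W) {η C : ℝ} (hη : 0 < η) (hC : 0 ≤ C)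
    (hD : ∀ᵐ t, t ∈ Ioo 0 T → 2 * W t (X t) ≤ -η * ‖u t‖ ^ 2 + C) {t : ℝ} (ht : t ∈ Ico 0 T) :
    ‖u t‖ ^ 2 ≤ ‖u 0‖ ^ 2 * Real.exp (-η * t) + C / η := by
  have hint : Integrable fun s => W s (X s) := integrable_dual_pairing h.memW h.memX
  -- The energy identity upgrades weak continuity: `‖u‖²` is a constant plus a primitive.
  have hc : ContinuousOn (fun s => ‖u s‖ ^ 2) (Icc 0 t) := by
    have c1 : Continuous fun s => ‖u 0‖ ^ 2 + 2 * ∫ r in (0 : ℝ)..s, W r (X r) :=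
      continuous_const.add ((hint.continuous_primitive 0).const_mul 2)
    refine c1.continuousOn.congr fun s hs => ?_
    have := h.energy_identity le_rfl hs.1 (hs.2.trans_lt ht.2)
    simp only
    linarith
  have hc' : ContinuousOn (fun s => -η * ‖u s‖ ^ 2 + C) (Icc 0 t) :=
    (continuousOn_const.mul hc).add continuousOn_const
  -- Gronwall in terms of right difference quotients suits an inequality known only almost
  -- everywhere: the quotient is an average of `2⟨W, X⟩`, bounded by the average of the continuous
  -- function `-η‖u‖² + C`.
  have key := le_gronwallBound_of_liminf_deriv_right_le (f := fun s => ‖u s‖ ^ 2)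
    (f' := fun s => -η * ‖u s‖ ^ 2 + C) (δ := ‖u 0‖ ^ 2) (K := -η) (ε := C) (a := 0) (b := t) hc
    (fun x hx r hr => ?_) le_rfl (fun x _ => le_rfl) t ⟨ht.1, le_rfl⟩
  · refine key.trans ?_
    rw [gronwallBound_of_K_ne_0 (neg_ne_zero.2 hη.ne'), sub_zero]
    beta_reduce
    have : C / -η * (Real.exp (-η * t) - 1) = C / η - C / η * Real.exp (-η * t) := by
      rw [div_neg]; ring
    rw [this]
    have : 0 ≤ C / η * Real.exp (-η * t) := by positivity
    linarith
  · refine Eventually.frequently ?_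
    filter_upwards [(tendsto_average_right hc' hx).eventually_lt_const hr,
      Ioo_mem_nhdsGT hx.2] with z hz hzx
    refine lt_of_le_of_lt ?_ hz
    refine mul_le_mul_of_nonneg_left ?_ (inv_nonneg.2 (sub_nonneg.2 hzx.1.le))
    rw [h.energy_identity hx.1 hzx.1.le (hzx.2.trans ht.2), ← intervalIntegral.integral_const_mul]
    refine intervalIntegral.integral_mono_ae_restrict hzx.1.le
      (hint.intervalIntegrable.const_mul 2)
      ((hc'.mono fun y hy => ⟨hx.1.trans hy.1, hy.2.trans hzx.2.le⟩).intervalIntegrable_of_Icc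
        hzx.1.le) ?_
    have hne : ∀ᵐ y, y ≠ x := compl_mem_ae_iff.2 (measure_singleton (μ := volume) x)
    rw [Filter.EventuallyLE, ae_restrict_iff' measurableSet_Icc]
    filter_upwards [hD, hne] with y hy hyx hym
    exact hy ⟨hx.1.trans_lt (lt_of_le_of_ne hym.1 hyx.symm),
      hym.2.trans_lt (hzx.2.trans ht.2)⟩

end GelfandPath

end Triple

/-! ### Weak gradients -/

lemma pd_mul {f g : Plane → ℝ} {x : Plane} (i : Fin 2) (hf : DifferentiableAt ℝ f x)
    (hg : DifferentiableAt ℝ g x) :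
    pd i (fun y => f y * g y) x = f x * pd i g x + pd i f x * g x := by
  simp only [pd]
  rw [fderiv_fun_mul hf hg]
  simp [mul_comm]

lemma pd_comp_sub_const (f : Plane → ℝ) (i : Fin 2) (y x : Plane) :
    pd i (fun z => f (z - y)) x = pd i f (x - y) := by
  simp only [pd, fderiv_comp_sub]

lemma pd_comp_const_sub {f : Plane → ℝ} (hf : Differentiable ℝ f) (i : Fin 2) (y x : Plane) :
    pd i (fun z => f (x - z)) y = - pd i f (x - y) := by
  have h : HasFDerivAt (fun z => f (x - z)) ((fderiv ℝ f (x - y)).comp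
      (-ContinuousLinearMap.id ℝ Plane)) y :=
    (hf (x - y)).hasFDerivAt.comp y ((hasFDerivAt_id y).const_sub x)
  simp [pd, h.fderiv]

namespace IsTest

variable {Ω : Set Plane} {η : Plane → ℝ}

lemma continuous_pd (h : IsTest Ω η) (i : Fin 2) : Continuous (pd i η) :=
  (h.smooth.continuous_fderiv (by simp)).clm_apply continuous_const

lemma differentiable (h : IsTest Ω η) : Differentiable ℝ η :=
  h.smooth.differentiable (by simp)

lemma smooth_mul (h : IsTest Ω η) {f : Plane → ℝ} (hf : ContDiff ℝ ∞ f) :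
    IsTest Ω (fun x => f x * η x) where
  smooth := hf.mul h.smooth
  compact := h.compact.mul_left
  support := (closure_mono (Function.support_mul_subset_right f η)).trans h.support

lemma eq_zero (h : IsTest Ω η) {x : Plane} (hx : x ∉ Ω) : η x = 0 :=
  image_eq_zero_of_notMem_tsupport fun hc => hx (h.support hc)

lemma compact_pd (h : IsTest Ω η) (i : Fin 2) : HasCompactSupport (pd i η) :=
  (h.compact.fderiv ℝ).comp_left (g := fun T : Plane →L[ℝ] ℝ =>
    T (EuclideanSpace.single i 1)) (by simp)

lemma bounded (h : IsTest Ω η) : ∃ C, 0 ≤ C ∧ ∀ x, |η x| ≤ C := by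
  obtain ⟨C, hC⟩ := h.compact.exists_bound_of_continuous h.smooth.continuous
  exact ⟨C, (norm_nonneg _).trans (hC 0), hC⟩

lemma bounded_pd (h : IsTest Ω η) (i : Fin 2) : ∃ C, 0 ≤ C ∧ ∀ x, |pd i η x| ≤ C := by
  obtain ⟨C, hC⟩ := (h.compact_pd i).exists_bound_of_continuous (h.continuous_pd i)
  exact ⟨C, (norm_nonneg _).trans (hC 0), hC⟩

lemma isWeakGrad (h : IsTest Ω η) : IsWeakGrad Ω η (fun i => pd i η) := by
  intro χ hχ i
  rw [setIntegral_eq_integral_of_forall_compl_eq_zero (fun x hx => by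
      rw [h.eq_zero hx, zero_mul]), setIntegral_eq_integral_of_forall_compl_eq_zero (fun x hx => by
      rw [hχ.eq_zero hx, mul_zero])]
  have c1 : Continuous η := h.smooth.continuous
  have c2 : Continuous χ := hχ.smooth.continuous
  exact integral_mul_fderiv_eq_neg_fderiv_mul_of_integrable
    (((h.continuous_pd i).mul c2).integrable_of_hasCompactSupport hχ.compact.mul_left)
    ((c1.mul (hχ.continuous_pd i)).integrable_of_hasCompactSupport h.compact.mul_right)
    ((c1.mul c2).integrable_of_hasCompactSupport h.compact.mul_right)
    (fun x _ => h.differentiable x) (fun x _ => hχ.differentiable x)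

end IsTest

lemma IsWeakGrad.congr {Ω : Set Plane} {f f' : Plane → ℝ} {g g' : Fin 2 → Plane → ℝ}
    (h : IsWeakGrad Ω f g) (hf : f =ᵐ[volume.restrict Ω] f')
    (hg : ∀ i, g i =ᵐ[volume.restrict Ω] g' i) : IsWeakGrad Ω f' g' := by
  intro η hη i
  refine (integral_congr_ae (hf.symm.mul (ae_eq_refl (pd i η)))).trans ((h η hη i).trans ?_)
  rw [neg_inj]
  exact integral_congr_ae ((hg i).mul (ae_eq_refl η))

lemma IsWeakGrad.unique {Ω : Set Plane} (hΩ : IsOpen Ω) {f : Plane → ℝ}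
    {g g' : Fin 2 → Plane → ℝ} (h : IsWeakGrad Ω f g) (h' : IsWeakGrad Ω f g')
    (hg : ∀ i, IntegrableOn (g i) Ω) (hg' : ∀ i, IntegrableOn (g' i) Ω) (i : Fin 2) :
    g i =ᵐ[volume.restrict Ω] g' i := by
  have key : ∀ᵐ x, x ∈ Ω → (g i - g' i) x = 0 := by
    refine hΩ.ae_eq_zero_of_integral_contDiff_smul_eq_zero
      ((hg i).sub (hg' i)).locallyIntegrableOn fun η h1 h2 h3 => ?_
    have hη : IsTest Ω η := ⟨h1, h2, h3⟩
    obtain ⟨C, -, hC⟩ := hη.bounded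
    have hi : ∀ k : Plane → ℝ, IntegrableOn k Ω → IntegrableOn (fun x => k x * η x) Ω :=
      fun k hk => hk.mul_bdd hη.smooth.continuous.aestronglyMeasurable (ae_of_all _ hC)
    have e := (h η hη i).symm.trans (h' η hη i)
    rw [← setIntegral_eq_integral_of_forall_compl_eq_zero (s := Ω) (fun x hx => by
      rw [hη.eq_zero hx, zero_smul])]
    simp only [smul_eq_mul, Pi.sub_apply, mul_comm (η _), sub_mul]
    rw [integral_sub (hi _ (hg i)) (hi _ (hg' i))]
    linarith
  rw [Filter.EventuallyEq, ae_restrict_iff' hΩ.measurableSet]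
  filter_upwards [key] with x hx hxΩ
  exact sub_eq_zero.1 (hx hxΩ)

/-! ### Mollification and the product rule. -/

/-- The normalized bump functions used for mollification. -/
def mollifier (n : ℕ) : Plane → ℝ := (shrinkingBump Plane n).normed volume

lemma mollifier_contDiff (n : ℕ) : ContDiff ℝ ∞ (mollifier n) :=
  (shrinkingBump Plane n).contDiff_normed

lemma mollifier_neg (n : ℕ) (x : Plane) : mollifier n (-x) = mollifier n x :=
  ContDiffBump.normed_neg _ x

lemma mollifier_sub_comm (n : ℕ) (x y : Plane) : mollifier n (x - y) = mollifier n (y - x) := by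
  rw [← mollifier_neg, neg_sub]

lemma isTest_mollifier (n : ℕ) : IsTest univ (mollifier n) :=
  ⟨mollifier_contDiff n, ContDiffBump.hasCompactSupport_normed _, subset_univ _⟩

lemma abs_integral_mollifier_le {Ω : Set Plane} (n : ℕ) {A : Plane → ℝ} {M : ℝ} (hM : 0 ≤ M)
    (bA : ∀ᵐ x ∂(volume.restrict Ω), |A x| ≤ M) (y : Plane) :
    |∫ x in Ω, mollifier n (x - y) * A x| ≤ M := by
  have hi : Integrable (fun x => mollifier n (x - y) * M) :=
    (((shrinkingBump Plane n).integrable_normed (μ := volume)).comp_sub_right y).mul_const M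
  have hn : ∀ x, 0 ≤ mollifier n (x - y) := fun x => (shrinkingBump Plane n).nonneg_normed _
  calc |∫ x in Ω, mollifier n (x - y) * A x| ≤ ∫ x in Ω, mollifier n (x - y) * M := by
        rw [← Real.norm_eq_abs]
        refine norm_integral_le_of_norm_le hi.integrableOn ?_
        filter_upwards [bA] with x hx
        rw [norm_mul, Real.norm_of_nonneg (hn x)]
        exact mul_le_mul_of_nonneg_left hx (hn x)
    _ ≤ ∫ x, mollifier n (x - y) * M :=
        setIntegral_le_integral hi (ae_of_all _ fun x => mul_nonneg (hn x) hM)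
    _ = M := by
        rw [integral_mul_const, integral_sub_right_eq_self (fun x => mollifier n x) y]
        have : ∫ x, mollifier n x = 1 := (shrinkingBump Plane n).integral_normed
        rw [this, one_mul]

/-- Mollified functions converge almost everywhere by Lebesgue differentiation and keep the bound
`M`. Dominated convergence then needs no more than integrability of `B`, which is all that is known
of the gradients in the product rule. -/
lemma tendsto_mollifier_pairing {Ω : Set Plane} (hΩ : MeasurableSet Ω) {A B : Plane → ℝ} {M : ℝ}
    (hM : 0 ≤ M) (mA : Measurable A) (bA : ∀ᵐ x ∂(volume.restrict Ω), |A x| ≤ M)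
    (hB : IntegrableOn B Ω) :
    Tendsto (fun n => ∫ y in Ω, B y * ∫ x in Ω, mollifier n (x - y) * A x) atTop
      (𝓝 (∫ y in Ω, B y * A y)) := by
  have hloc : LocallyIntegrable (Ω.indicator A) volume := by
    refine (locallyIntegrable_const M).mono (mA.indicator hΩ).aestronglyMeasurable ?_
    filter_upwards [(ae_restrict_iff' hΩ).1 bA] with x hx
    by_cases hxΩ : x ∈ Ω
    · simpa [hxΩ, abs_of_nonneg hM] using hx hxΩ
    · simp [hxΩ]
  -- `K = 2` is the ratio of the outer to the inner radius in `shrinkingBump`.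
  have hlim := ContDiffBump.ae_convolution_tendsto_right_of_locallyIntegrable (μ := volume)
    (φ := shrinkingBump Plane) (K := 2) tendsto_rOut_shrinkingBump
    (Eventually.of_forall fun n => by
      simp only [shrinkingBump]
      apply le_of_eq
      field_simp) hloc
  refine tendsto_integral_of_dominated_convergence (fun y => ‖B y‖ * M)
    (fun n => hB.aestronglyMeasurable.mul ?_) (hB.norm.mul_const M)
    (fun n => ae_of_all _ fun y => ?_) ?_
  · refine StronglyMeasurable.aestronglyMeasurable (StronglyMeasurable.integral_prod_left'
      (f := fun p : Plane × Plane => mollifier n (p.1 - p.2) * A p.1) ?_)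
    exact (((mollifier_contDiff n).continuous.measurable.comp
      (measurable_fst.sub measurable_snd)).mul (mA.comp measurable_fst)).stronglyMeasurable
  · rw [norm_mul]
    exact mul_le_mul_of_nonneg_left (abs_integral_mollifier_le n hM bA y) (norm_nonneg _)
  · filter_upwards [ae_restrict_of_ae hlim, ae_restrict_mem hΩ] with y hy hyΩ
    rw [indicator_of_mem hyΩ] at hy
    refine (hy.congr fun n => ?_).const_mul _
    rw [convolution_eq_swap, ← integral_indicator hΩ]
    congr 1
    ext x
    by_cases hx : x ∈ Ω
    · simp only [hx, indicator_of_mem, ContinuousLinearMap.lsmul_apply, smul_eq_mul]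
      rw [mollifier_sub_comm]
      rfl
    · simp [hx]

lemma integral_kernel_swap {Ω : Set Plane} {k a b : Plane → ℝ} (hk : Continuous k) {C : ℝ}
    (bk : ∀ x, |k x| ≤ C) (ha : IntegrableOn a Ω) (hb : IntegrableOn b Ω) :
    ∫ y in Ω, b y * ∫ x in Ω, k (x - y) * a x = ∫ x in Ω, a x * ∫ y in Ω, k (x - y) * b y := by
  have hi : Integrable (fun p : Plane × Plane => b p.1 * (k (p.2 - p.1) * a p.2))
      ((volume.restrict Ω).prod (volume.restrict Ω)) := by
    refine ((hb.mul_prod ha).bdd_mul (c := C) (f := fun p => k (p.2 - p.1))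
      (by fun_prop : Continuous fun p : Plane × Plane => k (p.2 - p.1)).aestronglyMeasurable
      (ae_of_all _ fun p => bk _)).congr (ae_of_all _ fun p => by ring)
  simp only [← integral_const_mul]
  rw [integral_integral_swap hi]
  refine integral_congr_ae (ae_of_all _ fun x => integral_congr_ae (ae_of_all _ fun y => ?_))
  ring

/-- The product rule for weak gradients of bounded functions. -/
theorem IsWeakGrad.mul {Ω : Set Plane} (hΩ : IsOpen Ω) (hfin : volume Ω ≠ ⊤)
    {f g : Plane → ℝ} {f' g' : Fin 2 → Plane → ℝ} (hf : IsWeakGrad Ω f f')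
    (hg : IsWeakGrad Ω g g') (mf : Measurable f) (mg : Measurable g) {M N : ℝ}
    (bf : ∀ᵐ x ∂(volume.restrict Ω), |f x| ≤ M) (bg : ∀ᵐ x ∂(volume.restrict Ω), |g x| ≤ N)
    (if' : ∀ i, IntegrableOn (f' i) Ω) (ig' : ∀ i, IntegrableOn (g' i) Ω) :
    IsWeakGrad Ω (fun x => f x * g x) (fun i x => f x * g' i x + g x * f' i x) := by
  intro η hη i
  have : IsFiniteMeasure (volume.restrict Ω) := ⟨by simpa using hfin.lt_top⟩
  have mΩ := hΩ.measurableSet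
  obtain ⟨C, hC0, hC⟩ := hη.bounded
  obtain ⟨D, hD0, hD⟩ := hη.bounded_pd i
  have mη : Measurable η := hη.smooth.continuous.measurable
  have mpη : Measurable (pd i η) := (hη.continuous_pd i).measurable
  have bf' : ∀ᵐ x ∂(volume.restrict Ω), |f x| ≤ |M| := bf.mono fun x hx => hx.trans (le_abs_self M)
  have bg' : ∀ᵐ x ∂(volume.restrict Ω), |g x| ≤ |N| := bg.mono fun x hx => hx.trans (le_abs_self N)
  have intf : IntegrableOn f Ω := Integrable.of_bound mf.aestronglyMeasurable _ bf
  have intg : IntegrableOn g Ω := Integrable.of_bound mg.aestronglyMeasurable _ bg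
  have igη : IntegrableOn (fun x => g x * η x) Ω :=
    intg.mul_bdd mη.aestronglyMeasurable (ae_of_all _ hC)
  have igpη : IntegrableOn (fun x => g x * pd i η x) Ω :=
    intg.mul_bdd mpη.aestronglyMeasurable (ae_of_all _ hD)
  have ig'η : IntegrableOn (fun x => g' i x * η x) Ω :=
    (ig' i).mul_bdd mη.aestronglyMeasurable (ae_of_all _ hC)
  have ρc : ∀ n, Continuous (mollifier n) := fun n => (mollifier_contDiff n).continuous
  obtain ⟨ε, hε, hεΩ⟩ := hη.compact.exists_cthickening_subset_open hΩ hη.support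
  -- Test the weak gradient of `g` with `x ↦ ρₙ(x - y) η(x)` (`E1`), multiply by `f y` and integrate
  -- over `y`. After Fubini, the derivative falling on `ρₙ` is transferred to `f` (`E2`, `F1`). No
  -- derivative of `ρₙ` remains, so all three terms converge.
  have key : ∀ᶠ n in atTop,
      (∫ y in Ω, f' i y * ∫ x in Ω, mollifier n (x - y) * (g x * η x))
        + (∫ y in Ω, f y * ∫ x in Ω, mollifier n (x - y) * (g x * pd i η x))
      = -∫ x in Ω, (g' i x * η x) * ∫ y in Ω, mollifier n (y - x) * f y := by
    filter_upwards [(tendsto_rOut_shrinkingBump (E := Plane)).eventually_lt_const hε] with n hn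
    obtain ⟨R, -, hR⟩ := (isTest_mollifier n).bounded
    obtain ⟨R', -, hR'⟩ := (isTest_mollifier n).bounded_pd i
    have dρ : Differentiable ℝ (mollifier n) := (isTest_mollifier n).differentiable
    have cρ' := (isTest_mollifier n).continuous_pd i
    have E1 : ∀ y, (∫ x in Ω, pd i (mollifier n) (x - y) * (g x * η x))
        + (∫ x in Ω, mollifier n (x - y) * (g x * pd i η x))
        = -∫ x in Ω, mollifier n (x - y) * (g' i x * η x) := fun y => by
      have ht := hη.smooth_mul (f := fun x => mollifier n (x - y))
        ((mollifier_contDiff n).comp (contDiff_id.sub contDiff_const))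
      have := hg _ ht i
      rw [← integral_add]
      · rw [integral_congr_ae (g := fun x => g x * pd i (fun x => mollifier n (x - y) * η x) x)]
        · rw [this]
          congr 1
          exact integral_congr_ae (ae_of_all _ fun x => by ring)
        · refine ae_of_all _ fun x => ?_
          simp only
          rw [pd_mul i (f := fun x => mollifier n (x - y))
            (dρ.comp (differentiable_id.sub_const y) x) (hη.differentiable x), pd_comp_sub_const]
          ring
      · exact igη.bdd_mul (cρ'.comp (continuous_id.sub continuous_const)).aestronglyMeasurable
          (ae_of_all _ fun x => hR' _)
      · exact igpη.bdd_mul ((ρc n).comp (continuous_id.sub continuous_const)).aestronglyMeasurable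
          (ae_of_all _ fun x => hR _)
    -- Only for `x` in the support of `η`, which has distance more than the mollification radius
    -- from the complement of `Ω`, is `y ↦ ρₙ(x - y)` a test function in `Ω`.
    have E2 : ∀ x ∈ tsupport η, ∫ y in Ω, pd i (mollifier n) (x - y) * f y
        = ∫ y in Ω, mollifier n (x - y) * f' i y := fun x hx => by
      have hs : tsupport (fun y => mollifier n (x - y)) ⊆ Metric.closedBall x ε := by
        refine closure_minimal (fun y hy => ?_) Metric.isClosed_closedBall
        have h1 : x - y ∈ Function.support (mollifier n) := hy
        rw [mollifier, ContDiffBump.support_normed_eq, mem_ball_zero_iff] at h1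
        rw [Metric.mem_closedBall, dist_comm, dist_eq_norm]
        exact (h1.trans hn).le
      have ht : IsTest Ω (fun y => mollifier n (x - y)) :=
        ⟨(mollifier_contDiff n).comp (contDiff_const.sub contDiff_id),
          (isCompact_closedBall x ε).of_isClosed_subset (isClosed_tsupport _) hs,
          hs.trans ((Metric.closedBall_subset_cthickening hx ε).trans hεΩ)⟩
      have := hf _ ht i
      simp only [pd_comp_const_sub dρ, mul_neg, integral_neg, neg_inj] at this
      simpa only [mul_comm] using this
    have F1 : ∫ y in Ω, f' i y * ∫ x in Ω, mollifier n (x - y) * (g x * η x)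
        = ∫ y in Ω, f y * ∫ x in Ω, pd i (mollifier n) (x - y) * (g x * η x) := by
      rw [integral_kernel_swap (ρc n) hR igη (if' i), integral_kernel_swap cρ' hR' igη intf]
      refine integral_congr_ae (ae_of_all _ fun x => ?_)
      by_cases hx : x ∈ tsupport η
      · simp only [E2 x hx]
      · simp [image_eq_zero_of_notMem_tsupport hx]
    have F3 : ∫ x in Ω, (g' i x * η x) * ∫ y in Ω, mollifier n (y - x) * f y
        = ∫ y in Ω, f y * ∫ x in Ω, mollifier n (x - y) * (g' i x * η x) := by
      rw [integral_kernel_swap (ρc n) hR ig'η intf]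
      simp only [mollifier_sub_comm n]
    have hmeas : ∀ {k : Plane → ℝ}, Continuous k → (∃ C, ∀ x, |k x| ≤ C) → ∀ a : Plane → ℝ,
        IntegrableOn a Ω → IntegrableOn (fun y => f y * ∫ x in Ω, k (x - y) * a x) Ω := by
      rintro k hk ⟨C, hC⟩ a ha
      have hi : Integrable (fun p : Plane × Plane => f p.1 * (k (p.2 - p.1) * a p.2))
          ((volume.restrict Ω).prod (volume.restrict Ω)) := by
        refine ((intf.mul_prod ha).bdd_mul (c := C) (f := fun p => k (p.2 - p.1))
          (by fun_prop : Continuous fun p : Plane × Plane => k (p.2 - p.1)).aestronglyMeasurable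
          (ae_of_all _ fun p => hC _)).congr (ae_of_all _ fun p => by ring)
      have h2 := hi.integral_prod_left
      simp only [integral_const_mul] at h2
      exact h2
    rw [F1, F3, ← integral_add (hmeas cρ' ⟨R', hR'⟩ _ igη) (hmeas (ρc n) ⟨R, hR⟩ _ igpη),
      ← integral_neg]
    refine integral_congr_ae (ae_of_all _ fun y => ?_)
    simp only
    rw [← mul_add, E1 y, mul_neg]
  have T1 := tendsto_mollifier_pairing mΩ (mul_nonneg (abs_nonneg N) hC0) (mg.mul mη)
    (bg'.mono fun x hx => by
      rw [Pi.mul_apply, abs_mul]; exact mul_le_mul hx (hC x) (abs_nonneg _) (abs_nonneg _)) (if' i)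
  have T2 := tendsto_mollifier_pairing mΩ (mul_nonneg (abs_nonneg N) hD0) (mg.mul mpη)
    (bg'.mono fun x hx => by
      rw [Pi.mul_apply, abs_mul]; exact mul_le_mul hx (hD x) (abs_nonneg _) (abs_nonneg _)) intf
  have T3 := tendsto_mollifier_pairing mΩ (abs_nonneg M) mf bf' ig'η
  have := tendsto_nhds_unique ((T1.add T2).congr' key) T3.neg
  have i1 : IntegrableOn (fun x => f' i x * (g x * η x)) Ω :=
    (if' i).mul_bdd (mg.mul mη).aestronglyMeasurable (c := |N| * C)
      (bg'.mono fun x hx => by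
        rw [norm_mul]; exact mul_le_mul hx (hC x) (abs_nonneg _) (abs_nonneg _))
  have i3 : IntegrableOn (fun x => g' i x * η x * f x) Ω :=
    ig'η.mul_bdd mf.aestronglyMeasurable bf
  simp only [Pi.mul_apply] at this
  have e1 : ∫ x in Ω, f x * g x * pd i η x = ∫ x in Ω, f x * (g x * pd i η x) := by
    simp only [mul_assoc]
  have e2 : ∫ x in Ω, (f x * g' i x + g x * f' i x) * η x
      = (∫ x in Ω, g' i x * η x * f x) + ∫ x in Ω, f' i x * (g x * η x) := by
    rw [← integral_add i3 i1]
    refine integral_congr_ae (ae_of_all _ fun x => ?_)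
    ring
  rw [e1, e2]
  linarith

/-! ### Convolution with the kernel -/

/-- `∫_Ω k(x - y) ψ(y) dy` for a function `ψ`. -/
def kerConv (Ω : Set Plane) (k ψ : Plane → ℝ) (x : Plane) : ℝ := ∫ y in Ω, k (x - y) * ψ y

lemma kerA_eq_kerConv (Ω : Set Plane) (k : Plane → ℝ) : kerA Ω k = kerConv Ω k fun _ => 1 := by
  ext x
  simp [kerA, kerConv]

lemma measurable_kerConv {Ω : Set Plane} {k ψ : Plane → ℝ} (mk : Measurable k)
    (mψ : Measurable ψ) : Measurable (kerConv Ω k ψ) := by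
  refine StronglyMeasurable.measurable (StronglyMeasurable.integral_prod_right'
    (f := fun p : Plane × Plane => k (p.1 - p.2) * ψ p.2) ?_)
  exact ((mk.comp (measurable_fst.sub measurable_snd)).mul
    (mψ.comp measurable_snd)).stronglyMeasurable

lemma kerConv_congr {Ω : Set Plane} {k ψ ψ' : Plane → ℝ} (h : ψ =ᵐ[volume.restrict Ω] ψ') :
    kerConv Ω k ψ = kerConv Ω k ψ' := by
  ext x
  exact integral_congr_ae ((ae_eq_refl fun y => k (x - y)).mul h)

lemma abs_kerConv_le {Ω : Set Plane} {k ψ : Plane → ℝ} (mk : Measurable k)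
    {S : ℝ≥0∞} (hS : S < ⊤) (hk : ∀ x ∈ Ω, ∫⁻ y in Ω, ‖k (x - y)‖ₑ ≤ S)
    (bψ : ∀ᵐ x ∂(volume.restrict Ω), |ψ x| ≤ 1) {x : Plane} (hx : x ∈ Ω) :
    |kerConv Ω k ψ x| ≤ S.toReal := by
  have hi : IntegrableOn (fun y => k (x - y)) Ω :=
    ⟨(mk.comp (measurable_const.sub measurable_id)).aestronglyMeasurable, (hk x hx).trans_lt hS⟩
  calc |kerConv Ω k ψ x| ≤ ∫ y in Ω, ‖k (x - y)‖ := by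
        rw [← Real.norm_eq_abs]
        refine norm_integral_le_of_norm_le hi.norm ?_
        filter_upwards [bψ] with y hy
        rw [norm_mul]
        exact mul_le_of_le_one_right (norm_nonneg _) hy
    _ ≤ S.toReal := by
        rw [integral_norm_eq_lintegral_enorm hi.aestronglyMeasurable]
        exact ENNReal.toReal_mono hS.ne (hk x hx)

lemma integrable_kerConv_prod {Ω : Set Plane} (hΩ : MeasurableSet Ω) (hfin : volume Ω ≠ ⊤)
    {k ψ η : Plane → ℝ} (mk : Measurable k)
    {S : ℝ≥0∞} (hS : S < ⊤) (hk : ∀ x ∈ Ω, ∫⁻ y in Ω, ‖k (x - y)‖ₑ ≤ S)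
    (mψ : Measurable ψ) (bψ : ∀ x, |ψ x| ≤ 1) (mη : Measurable η) {C : ℝ} (bη : ∀ x, |η x| ≤ C) :
    Integrable (fun p : Plane × Plane => k (p.1 - p.2) * ψ p.2 * η p.1)
      ((volume.restrict Ω).prod (volume.restrict Ω)) := by
  have hi : Integrable (fun p : Plane × Plane => k (p.1 - p.2))
      ((volume.restrict Ω).prod (volume.restrict Ω)) := by
    have m : Measurable fun p : Plane × Plane => k (p.1 - p.2) :=
      mk.comp (measurable_fst.sub measurable_snd)
    refine ⟨m.aestronglyMeasurable, ?_⟩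
    rw [HasFiniteIntegral, lintegral_prod _ m.enorm.aemeasurable]
    calc ∫⁻ x in Ω, ∫⁻ y in Ω, ‖k (x - y)‖ₑ ≤ ∫⁻ _ in Ω, S := setLIntegral_mono' hΩ hk
      _ < ⊤ := by
        rw [setLIntegral_const]
        exact ENNReal.mul_lt_top hS hfin.lt_top
  exact (hi.mul_bdd (mψ.comp measurable_snd).aestronglyMeasurable
    (ae_of_all _ fun p => bψ p.2)).mul_bdd (mη.comp measurable_fst).aestronglyMeasurable
    (ae_of_all _ fun p => bη p.1)

lemma lintegral_le_aSup {Ω : Set Plane} {J : Plane → ℝ} (x : Plane) (hx : x ∈ Ω) :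
    ∫⁻ y in Ω, ‖J (x - y)‖ₑ ≤ aSup Ω J :=
  le_iSup₂ (f := fun x _ => ∫⁻ y in Ω, ‖J (x - y)‖ₑ) x hx

lemma lintegral_le_bSup {Ω : Set Plane} {DJ : Fin 2 → Plane → ℝ} (i : Fin 2) (x : Plane)
    (hx : x ∈ Ω) : ∫⁻ y in Ω, ‖DJ i (x - y)‖ₑ ≤ bSup Ω DJ := by
  refine le_trans (lintegral_mono fun y => ?_)
    (le_iSup₂ (f := fun x _ => ∫⁻ y in Ω, ‖(!₂[DJ 0 (x - y), DJ 1 (x - y)] : Plane)‖ₑ) x hx)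
  rw [enorm_le_iff_norm_le]
  have := PiLp.norm_apply_le (!₂[DJ 0 (x - y), DJ 1 (x - y)] : Plane) i
  fin_cases i <;> simpa using this

/-- For almost every `y` the function `J(· - y)` has a weak gradient in `Ω`. Testing it, multiplying
by `ψ y` and integrating over `y` gives the claim by Fubini. The case `ψ = 1` covers `∇a`. -/
lemma KernelAssumption.isWeakGrad_kerConv {Ω : Set Plane} (hΩ : MeasurableSet Ω)
    (hfin : volume Ω ≠ ⊤) {J : Plane → ℝ} {DJ : Fin 2 → Plane → ℝ} (hJ : KernelAssumption Ω J DJ)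
    {ψ : Plane → ℝ} (mψ : Measurable ψ) (bψ : ∀ᵐ x ∂(volume.restrict Ω), |ψ x| ≤ 1) :
    IsWeakGrad Ω (kerConv Ω J ψ) (fun i => kerConv Ω (DJ i) ψ) := by
  -- Truncation changes `ψ` only on a null set of `Ω` and makes the bound valid everywhere, as the
  -- product integrability requires.
  let ψ' : Plane → ℝ := fun x => max (-1) (min 1 (ψ x))
  have mψ' : Measurable ψ' := measurable_const.max (measurable_const.min mψ)
  have bψ' : ∀ x, |ψ' x| ≤ 1 := fun x =>
    abs_le.2 ⟨le_max_left _ _, max_le (by norm_num) (min_le_left _ _)⟩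
  have hψ : ψ =ᵐ[volume.restrict Ω] ψ' := by
    filter_upwards [bψ] with x hx
    rw [abs_le] at hx
    simp only [ψ']
    rw [min_eq_right hx.2, max_eq_right hx.1]
  simp only [kerConv_congr hψ]
  intro η hη i
  obtain ⟨C, -, hC⟩ := hη.bounded
  obtain ⟨D, -, hD⟩ := hη.bounded_pd i
  have i1 := integrable_kerConv_prod hΩ hfin hJ.measurable hJ.aSup_lt_top
    lintegral_le_aSup mψ' bψ' (hη.continuous_pd i).measurable hD
  have i2 := integrable_kerConv_prod hΩ hfin (hJ.measurable_grad i) hJ.bSup_lt_top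
    (lintegral_le_bSup i) mψ' bψ' hη.smooth.continuous.measurable hC
  simp only [kerConv, ← integral_mul_const]
  rw [integral_integral_swap i1,
    integral_integral_swap (f := fun x y => DJ i (x - y) * ψ' y * η x) i2, ← integral_neg]
  refine integral_congr_ae ?_
  filter_upwards [hJ.weakGrad] with y hy
  have e := hy η hη i
  have a1 : ∫ x in Ω, J (x - y) * ψ' y * pd i η x
      = ψ' y * ∫ x in Ω, J (x - y) * pd i η x := by
    rw [← integral_const_mul]
    exact integral_congr_ae (ae_of_all _ fun x => by ring)
  have a2 : ∫ x in Ω, DJ i (x - y) * ψ' y * η x = ψ' y * ∫ x in Ω, DJ i (x - y) * η x := by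
    rw [← integral_const_mul]
    exact integral_congr_ae (ae_of_all _ fun x => by ring)
  rw [a1, a2, e, mul_neg]

/-! ### The spaces `H¹(Ω)` and `H¹₀(Ω)` -/

section H1

variable {Ω : Set Plane}

lemma h1_isWeakGrad (f : H1 Ω) : IsWeakGrad Ω (h1Fn f) (fun i => h1Grad f i) := f.2

lemma exists_h1 {f : Plane → ℝ} {g : Fin 2 → Plane → ℝ} (hf : MemLp f 2 (volume.restrict Ω))
    (hg : ∀ i, MemLp (g i) 2 (volume.restrict Ω)) (h : IsWeakGrad Ω f g) :
    ∃ F : H1 Ω, h1Fn F =ᵐ[volume.restrict Ω] f ∧ ∀ i, h1Grad F i =ᵐ[volume.restrict Ω] g i :=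
  ⟨⟨WithLp.toLp 2 (hf.toLp f, WithLp.toLp 2 fun i => (hg i).toLp (g i)),
    h.congr hf.coeFn_toLp.symm fun i => (hg i).coeFn_toLp.symm⟩,
    hf.coeFn_toLp, fun i => (hg i).coeFn_toLp⟩

lemma h1_norm_sq (f : H1 Ω) : ‖f‖ ^ 2 = ‖h1Fn f‖ ^ 2 + ∑ i, ‖h1Grad f i‖ ^ 2 := by
  have h1 : ‖f‖ = ‖f.1‖ := rfl
  rw [h1, WithLp.prod_norm_sq_eq_of_L2, PiLp.norm_sq_eq_of_L2]
  rfl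

lemma norm_h1Fn_le (f : H1 Ω) : ‖h1Fn f‖ ≤ ‖f‖ := by
  refine le_of_sq_le_sq ?_ (norm_nonneg _)
  rw [h1_norm_sq]
  exact le_add_of_nonneg_right (Finset.sum_nonneg fun i _ => sq_nonneg _)

lemma norm_h1Grad_le (f : H1 Ω) (i : Fin 2) : ‖h1Grad f i‖ ≤ ‖f‖ := by
  refine le_of_sq_le_sq ?_ (norm_nonneg _)
  rw [h1_norm_sq]
  exact (Finset.single_le_sum (f := fun i => ‖h1Grad f i‖ ^ 2) (fun i _ => sq_nonneg _)
    (Finset.mem_univ i)).trans (le_add_of_nonneg_left (sq_nonneg _))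

/-- The inclusion `H¹(Ω) → L²(Ω)`. -/
def h1FnL (Ω : Set Plane) : H1 Ω →L[ℝ] L2 Ω :=
  LinearMap.mkContinuous ⟨⟨h1Fn, fun _ _ => rfl⟩, fun _ _ => rfl⟩ 1 fun f => by
    rw [one_mul]; exact norm_h1Fn_le f

/-- The weak partial derivative `H¹(Ω) → L²(Ω)`. -/
def h1GradL (Ω : Set Plane) (i : Fin 2) : H1 Ω →L[ℝ] L2 Ω :=
  LinearMap.mkContinuous ⟨⟨fun f => h1Grad f i, fun f g => h1Grad_add f g i⟩,
    fun c f => h1Grad_smul c f i⟩ 1 fun f => by rw [one_mul]; exact norm_h1Grad_le f i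

@[simp] lemma h1FnL_apply (f : H1 Ω) : h1FnL Ω f = h1Fn f := rfl

@[simp] lemma h1GradL_apply (f : H1 Ω) (i : Fin 2) : h1GradL Ω i f = h1Grad f i := rfl

/-- The elements of `H¹(Ω)` given by test functions. -/
def testSet (Ω : Set Plane) : Set (H1 Ω) := {f | ∃ η, IsTest Ω η ∧ h1Fn f =ᵐ[volume.restrict Ω] η}

/-- Test functions already form a subspace. Hence elements of `H¹₀` are limits of single test
functions, and every closed property may be checked on these. -/
lemma span_testSet_subset {f : H1 Ω} (hf : f ∈ Submodule.span ℝ (testSet Ω)) : f ∈ testSet Ω := by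
  induction hf using Submodule.span_induction with
  | mem f hf => exact hf
  | zero =>
    refine ⟨fun _ => 0, ⟨contDiff_const, HasCompactSupport.zero, ?_⟩, Lp.coeFn_zero _ _ _⟩
    simp [tsupport]
  | add f g _ _ hf hg =>
    obtain ⟨η, hη, h1⟩ := hf
    obtain ⟨χ, hχ, h2⟩ := hg
    refine ⟨fun x => η x + χ x, ⟨hη.smooth.add hχ.smooth, hη.compact.add hχ.compact,
      (tsupport_add η χ).trans (union_subset hη.support hχ.support)⟩, ?_⟩
    filter_upwards [Lp.coeFn_add (h1Fn f) (h1Fn g), h1, h2] with x a b c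
    rw [← b, ← c]
    exact a
  | smul c f _ hf =>
    obtain ⟨η, hη, h1⟩ := hf
    refine ⟨fun x => c * η x, hη.smooth_mul contDiff_const, ?_⟩
    filter_upwards [Lp.coeFn_smul c (h1Fn f), h1] with x a b
    rw [← b]
    exact a

lemma mem_H10_iff {f : H1 Ω} : f ∈ H10 Ω ↔ f ∈ closure (testSet Ω) := by
  have : (Submodule.span ℝ (testSet Ω) : Set (H1 Ω)) = testSet Ω :=
    Subset.antisymm (fun _ h => span_testSet_subset h) Submodule.subset_span
  rw [← this]
  rfl

lemma testSet_subset_H10 {f : H1 Ω} (hf : f ∈ testSet Ω) : f ∈ H10 Ω :=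
  mem_H10_iff.2 (subset_closure hf)

/-- Membership in `testSet` fixes only the function; uniqueness of weak gradients identifies its
derivatives. -/
lemma h1Grad_of_test (hΩ : IsOpen Ω) (hfin : volume Ω ≠ ⊤) {f : H1 Ω} {η : Plane → ℝ}
    (hη : IsTest Ω η) (hf : h1Fn f =ᵐ[volume.restrict Ω] η) (i : Fin 2) :
    h1Grad f i =ᵐ[volume.restrict Ω] pd i η := by
  have : IsFiniteMeasure (volume.restrict Ω) := ⟨by simpa using hfin.lt_top⟩
  refine IsWeakGrad.unique hΩ ((h1_isWeakGrad f).congr hf fun i => ae_eq_refl _) hη.isWeakGrad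
    (fun j => (Lp.memLp (h1Grad f j)).integrable (by norm_num))
    (fun j => (hη.memLp_pd j).integrable (by norm_num)) i

lemma l2_inner_eq (f g : L2 Ω) : inner ℝ f g = ∫ x in Ω, f x * g x := by
  rw [L2.inner_def]
  refine integral_congr_ae (ae_of_all _ fun x => ?_)
  simp [mul_comm]

lemma l2_inner_eq_of_ae {f g : L2 Ω} {a b : Plane → ℝ} (hf : f =ᵐ[volume.restrict Ω] a)
    (hg : g =ᵐ[volume.restrict Ω] b) : inner ℝ f g = ∫ x in Ω, a x * b x := by
  rw [l2_inner_eq]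
  exact integral_congr_ae (hf.mul hg)

/-- Integration by parts for `H¹(Ω)` against `H¹₀(Ω)`. -/
lemma inner_h1Grad_H10 (hΩ : IsOpen Ω) (hfin : volume Ω ≠ ⊤) (G : H1 Ω) {w : H1 Ω}
    (hw : w ∈ H10 Ω) (i : Fin 2) :
    inner ℝ (h1Grad G i) (h1Fn w) = - inner ℝ (h1Fn G) (h1Grad w i) := by
  rw [mem_H10_iff] at hw
  have hc : IsClosed {w : H1 Ω |
      inner ℝ (h1Grad G i) (h1FnL Ω w) = - inner ℝ (h1Fn G) (h1GradL Ω i w)} :=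
    isClosed_eq (continuous_const.inner (h1FnL Ω).continuous)
      (continuous_const.inner (h1GradL Ω i).continuous).neg
  refine closure_minimal ?_ hc hw
  rintro f ⟨η, hη, hf⟩
  simp only [mem_ofPred_eq, h1FnL_apply, h1GradL_apply]
  rw [l2_inner_eq_of_ae (ae_eq_refl _) hf,
    l2_inner_eq_of_ae (ae_eq_refl _) (h1Grad_of_test hΩ hfin hη hf i), h1_isWeakGrad G η hη i,
    neg_neg]

/-- Gradients are orthogonal to divergence free fields. -/
lemma sum_inner_h1Grad_vFn (hΩ : IsOpen Ω) (hfin : volume Ω ≠ ⊤) (G : H1 Ω) (v : Vdiv Ω) :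
    ∑ i, inner ℝ (h1Grad G i) (vFn v i) = 0 := by
  have : ∀ i, inner ℝ (h1Grad G i) (vFn v i) = - inner ℝ (h1Fn G) (h1Grad (v.1 i) i) := fun i =>
    inner_h1Grad_H10 hΩ hfin G (v.2.1 i) i
  rw [Finset.sum_congr rfl fun i _ => this i, Finset.sum_neg_distrib, ← inner_sum, v.2.2,
    inner_zero_right, neg_zero]

end H1

/-! ### Sobolev inequality and the trilinear form -/

section Sobolev

variable {Ω : Set Plane}

instance holderTriple_four_four_two : ENNReal.HolderTriple 4 4 2 where
  inv_add_inv_eq_inv := by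
    rw [← ENNReal.toReal_eq_toReal_iff' (by simp) (by simp), ENNReal.toReal_add (by simp) (by simp)]
    norm_num

lemma norm_fderiv_le (η : Plane → ℝ) (x : Plane) : ‖fderiv ℝ η x‖ ≤ ∑ i, |pd i η x| := by
  refine ContinuousLinearMap.opNorm_le_bound _ (Finset.sum_nonneg fun i _ => abs_nonneg _)
    fun v => ?_
  have hv : v = ∑ i, v i • EuclideanSpace.single i (1 : ℝ) := by
    ext j
    fin_cases j <;> simp
  conv_lhs => rw [hv, map_sum]
  rw [Finset.sum_mul]
  refine (norm_sum_le _ _).trans (Finset.sum_le_sum fun i _ => ?_)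
  rw [map_smul, norm_smul, mul_comm]
  exact mul_le_mul_of_nonneg_left (PiLp.norm_apply_le v i) (abs_nonneg _)

/-- In the plane the Gagliardo-Nirenberg-Sobolev inequality takes a gradient in `L^{4/3}` to a
function in `L⁴`, as `3/4 - 1/2 = 1/4`. On the bounded set `Ω`, Hölder replaces `L^{4/3}` by `L²` at
the cost of `|Ω|^{1/4}`. -/
lemma exists_eLpNorm_four_le_test (hb : Bornology.IsBounded Ω) :
    ∃ C : ℝ≥0, ∀ η, IsTest Ω η → eLpNorm η 4 (volume.restrict Ω)
      ≤ C * ∑ i, eLpNorm (pd i η) 2 (volume.restrict Ω) := by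
  have hfin : volume Ω < ⊤ := hb.measure_lt_top
  have hKtop : (volume.restrict Ω univ : ℝ≥0∞) ^ ((1 : ℝ) / (4 / 3) - 1 / 2) ≠ ⊤ := by
    rw [Measure.restrict_apply_univ]
    exact ENNReal.rpow_ne_top_of_nonneg (by norm_num) hfin.ne
  lift (volume.restrict Ω univ : ℝ≥0∞) ^ ((1 : ℝ) / (4 / 3) - 1 / 2) to ℝ≥0 using hKtop with K hK
  refine ⟨eLpNormLESNormFDerivOfLeConst ℝ (volume : Measure Plane) Ω (4 / 3) 4 * K,
    fun η hη => ?_⟩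
  have hsupp : Function.support η ⊆ Ω := (subset_tsupport η).trans hη.support
  have e1 := eLpNorm_le_eLpNorm_fderiv_of_le (volume : Measure Plane) (p := 4 / 3) (q := 4)
    (hη.smooth.of_le (by simp)) hsupp
    (by rw [← NNReal.coe_le_coe]; norm_num)
    (by rw [← NNReal.coe_lt_coe]; norm_num)
    (by norm_num) hb
  have hs' : Function.support (fderiv ℝ η) ⊆ Ω :=
    ((subset_tsupport _).trans (tsupport_fderiv_subset ℝ)).trans hη.support
  have hcd : Continuous (fderiv ℝ η) := hη.smooth.continuous_fderiv (by simp)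
  have e2 : eLpNorm (fderiv ℝ η) ((4 / 3 : ℝ≥0) : ℝ≥0∞) volume
      ≤ eLpNorm (fderiv ℝ η) 2 (volume.restrict Ω) * K := by
    have hr := eLpNorm_restrict_eq_of_support_subset (μ := volume)
      (p := ((4 / 3 : ℝ≥0) : ℝ≥0∞)) (f := fderiv ℝ η) (s := Ω) hs'
    rw [← hr, hK]
    refine (eLpNorm_le_eLpNorm_mul_rpow_measure_univ (q := 2) ?_
      hcd.aestronglyMeasurable).trans_eq ?_
    · rw [show (2 : ℝ≥0∞) = ((2 : ℝ≥0) : ℝ≥0∞) by simp, ENNReal.coe_le_coe,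
        ← NNReal.coe_le_coe]
      norm_num
    · norm_num
  have e3 : eLpNorm (fderiv ℝ η) 2 (volume.restrict Ω)
      ≤ ∑ i, eLpNorm (pd i η) 2 (volume.restrict Ω) := by
    refine (eLpNorm_mono (g := ∑ i, fun x => |pd i η x|) fun x => ?_).trans
      ((eLpNorm_sum_le (fun i _ => (hη.continuous_pd i).abs.aestronglyMeasurable)
        (by norm_num)).trans_eq ?_)
    · rw [Finset.sum_apply]
      exact (norm_fderiv_le η x).trans (le_abs_self _)
    · exact Finset.sum_congr rfl fun i _ => eLpNorm_norm (pd i η)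
  calc eLpNorm η 4 (volume.restrict Ω) ≤ eLpNorm η 4 volume := eLpNorm_mono_measure _
        Measure.restrict_le_self
    _ ≤ _ := e1
    _ ≤ eLpNormLESNormFDerivOfLeConst ℝ (volume : Measure Plane) Ω (4 / 3) 4 *
        ((∑ i, eLpNorm (pd i η) 2 (volume.restrict Ω)) * K) := by
        gcongr
        exact e2.trans (by gcongr)
    _ = _ := by push_cast; ring

/-- The embedding of `H¹₀(Ω)` into `L⁴(Ω)`. -/
lemma exists_eLpNorm_four_le (hΩ : IsOpen Ω) (hb : Bornology.IsBounded Ω) :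
    ∃ C : ℝ≥0, ∀ f ∈ H10 Ω, eLpNorm (h1Fn f) 4 (volume.restrict Ω)
      ≤ C * ENNReal.ofReal (∑ i, ‖h1Grad f i‖) := by
  obtain ⟨C, hC⟩ := exists_eLpNorm_four_le_test hb
  refine ⟨C, fun f hf => ?_⟩
  obtain ⟨g, hg, hlim⟩ := mem_closure_iff_seq_limit.1 (mem_H10_iff.1 hf)
  have l1 : Tendsto (fun n => h1Fn (g n)) atTop (𝓝 (h1Fn f)) :=
    ((h1FnL Ω).continuous.tendsto f).comp hlim
  have l2 : ∀ i, Tendsto (fun n => h1Grad (g n) i) atTop (𝓝 (h1Grad f i)) := fun i =>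
    ((h1GradL Ω i).continuous.tendsto f).comp hlim
  -- The `L⁴` norm is lower semicontinuous under almost everywhere convergence, so a subsequence
  -- suffices.
  obtain ⟨ns, hns, hae⟩ := (tendstoInMeasure_of_tendsto_Lp l1).exists_seq_tendsto_ae
  have hle : ∀ n, eLpNorm (h1Fn (g n)) 4 (volume.restrict Ω)
      ≤ C * ENNReal.ofReal (∑ i, ‖h1Grad (g n) i‖) := fun n => by
    obtain ⟨η, hη, hgη⟩ := hg n
    rw [eLpNorm_congr_ae hgη, ENNReal.ofReal_sum_of_nonneg fun i _ => norm_nonneg _]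
    refine (hC η hη).trans_eq ?_
    congr 1
    refine Finset.sum_congr rfl fun i _ => ?_
    rw [← eLpNorm_congr_ae (h1Grad_of_test hΩ hb.measure_lt_top.ne hη hgη i), Lp.norm_def,
      ENNReal.ofReal_toReal (Lp.eLpNorm_ne_top _)]
  refine (Lp.eLpNorm_lim_le_liminf_eLpNorm (fun n => (Lp.aestronglyMeasurable (h1Fn (g (ns n)))))
    _ hae).trans ?_
  have l3 : Tendsto (fun n => (C : ℝ≥0∞) * ENNReal.ofReal (∑ i, ‖h1Grad (g (ns n)) i‖)) atTop
      (𝓝 (C * ENNReal.ofReal (∑ i, ‖h1Grad f i‖))) := by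
    refine ENNReal.Tendsto.const_mul ?_ (Or.inr ENNReal.coe_ne_top)
    exact (ENNReal.continuous_ofReal.tendsto _).comp
      (tendsto_finsetSum _ fun i _ => ((l2 i).comp hns.tendsto_atTop).norm)
  rw [← l3.liminf_eq]
  exact liminf_le_liminf (Eventually.of_forall fun n => hle _)

lemma memLp_four_of_mem_H10 (hΩ : IsOpen Ω) (hb : Bornology.IsBounded Ω) {f : H1 Ω}
    (hf : f ∈ H10 Ω) : MemLp (h1Fn f) 4 (volume.restrict Ω) := by
  obtain ⟨C, hC⟩ := exists_eLpNorm_four_le hΩ hb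
  exact ⟨Lp.aestronglyMeasurable _, (hC f hf).trans_lt
    (ENNReal.mul_lt_top ENNReal.coe_lt_top ENNReal.ofReal_lt_top)⟩

/-- The Poincaré inequality. -/
lemma exists_poincare (hΩ : IsOpen Ω) (hb : Bornology.IsBounded Ω) :
    ∃ C : ℝ, 0 ≤ C ∧ ∀ f ∈ H10 Ω, ‖h1Fn f‖ ≤ C * ∑ i, ‖h1Grad f i‖ := by
  obtain ⟨C, hC⟩ := exists_eLpNorm_four_le hΩ hb
  -- Poincaré follows from the `L⁴` embedding, since the `L²` norm is at most `|Ω|^{1/4}` times the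
  -- `L⁴` norm.
  have hKtop : (volume.restrict Ω univ : ℝ≥0∞) ^ ((1 : ℝ) / 2 - 1 / 4) ≠ ⊤ := by
    rw [Measure.restrict_apply_univ]
    exact ENNReal.rpow_ne_top_of_nonneg (by norm_num) hb.measure_lt_top.ne
  lift (volume.restrict Ω univ : ℝ≥0∞) ^ ((1 : ℝ) / 2 - 1 / 4) to ℝ≥0 using hKtop with K hK
  refine ⟨C * K, by positivity, fun f hf => ?_⟩
  have hs : 0 ≤ ∑ i, ‖h1Grad f i‖ := Finset.sum_nonneg fun i _ => norm_nonneg _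
  have e1 : eLpNorm (h1Fn f) 2 (volume.restrict Ω)
      ≤ C * ENNReal.ofReal (∑ i, ‖h1Grad f i‖) * K := by
    refine (eLpNorm_le_eLpNorm_mul_rpow_measure_univ (q := 4) (by norm_num)
      (Lp.aestronglyMeasurable _)).trans ?_
    simp only [hK, ENNReal.toReal_ofNat]
    gcongr
    exact hC f hf
  rw [Lp.norm_def]
  refine (ENNReal.toReal_mono (ENNReal.mul_ne_top (ENNReal.mul_ne_top ENNReal.coe_ne_top
    ENNReal.ofReal_ne_top) ENNReal.coe_ne_top) e1).trans_eq ?_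
  rw [ENNReal.toReal_mul, ENNReal.toReal_mul, ENNReal.toReal_ofReal hs]
  simp only [ENNReal.coe_toReal]
  ring

/-- Multiplication by an `L⁴` function is continuous from `H¹₀(Ω)` to `L²(Ω)`. -/
lemma exists_mulCLM (hΩ : IsOpen Ω) (hb : Bornology.IsBounded Ω) {a : Plane → ℝ}
    (ha : MemLp a 4 (volume.restrict Ω)) :
    ∃ L : H10 Ω →L[ℝ] L2 Ω, ∀ w : H10 Ω,
      L w =ᵐ[volume.restrict Ω] fun x => a x * h1Fn w.1 x := by
  obtain ⟨C, hC⟩ := exists_eLpNorm_four_le hΩ hb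
  have hm : ∀ w : H10 Ω, MemLp (fun x => a x * h1Fn w.1 x) 2 (volume.restrict Ω) := fun w =>
    (memLp_four_of_mem_H10 hΩ hb w.2).mul ha
  let l : H10 Ω →ₗ[ℝ] L2 Ω :=
    { toFun := fun w => (hm w).toLp _
      map_add' := fun v w => by
        ext1
        filter_upwards [(hm (v + w)).coeFn_toLp, Lp.coeFn_add ((hm v).toLp _) ((hm w).toLp _),
          (hm v).coeFn_toLp, (hm w).coeFn_toLp, Lp.coeFn_add (h1Fn v.1) (h1Fn w.1)]
          with x h1 h2 h3 h4 h5
        rw [h1, h2, Pi.add_apply, h3, h4, ← mul_add]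
        congr 1
      map_smul' := fun c w => by
        ext1
        filter_upwards [(hm (c • w)).coeFn_toLp, Lp.coeFn_smul c ((hm w).toLp _),
          (hm w).coeFn_toLp, Lp.coeFn_smul c (h1Fn w.1)] with x h1 h2 h3 h4
        rw [h1, RingHom.id_apply, h2, Pi.smul_apply, h3, smul_eq_mul, mul_left_comm]
        congr 1 }
  refine ⟨l.mkContinuous ((eLpNorm a 4 (volume.restrict Ω)).toReal * (C * 2)) fun w => ?_,
    fun w => (hm w).coeFn_toLp⟩
  have hs : 0 ≤ ∑ i, ‖h1Grad w.1 i‖ := Finset.sum_nonneg fun i _ => norm_nonneg _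
  have e1 : eLpNorm (fun x => a x * h1Fn w.1 x) 2 (volume.restrict Ω)
      ≤ eLpNorm a 4 (volume.restrict Ω) * (C * ENNReal.ofReal (∑ i, ‖h1Grad w.1 i‖)) :=
    (eLpNorm_smul_le_mul_eLpNorm (r := 2) (p := 4) (q := 4) (φ := a) (f := h1Fn w.1)
      (Lp.aestronglyMeasurable _) ha.1).trans (by gcongr; exact hC _ w.2)
  change ‖(hm w).toLp _‖ ≤ _
  rw [Lp.norm_toLp]
  refine (ENNReal.toReal_mono (ENNReal.mul_ne_top ha.eLpNorm_ne_top
    (ENNReal.mul_ne_top ENNReal.coe_ne_top ENNReal.ofReal_ne_top)) e1).trans ?_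
  rw [ENNReal.toReal_mul, ENNReal.toReal_mul, ENNReal.toReal_ofReal hs, ENNReal.coe_toReal,
    mul_assoc, mul_assoc]
  gcongr
  calc ∑ i, ‖h1Grad w.1 i‖ ≤ ∑ _i : Fin 2, ‖w‖ :=
        Finset.sum_le_sum fun i _ => norm_h1Grad_le w.1 i
    _ = 2 * ‖w‖ := by simp

lemma vFn_memLp_four (hΩ : IsOpen Ω) (hb : Bornology.IsBounded Ω) (v : Vdiv Ω) (i : Fin 2) :
    MemLp (vFn v i) 4 (volume.restrict Ω) :=
  memLp_four_of_mem_H10 hΩ hb (v.2.1 i)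

lemma integrable_trilinear {a b c : Plane → ℝ} (ha : MemLp a 4 (volume.restrict Ω))
    (hb : MemLp b 2 (volume.restrict Ω)) (hc : MemLp c 4 (volume.restrict Ω)) :
    IntegrableOn (fun x => a x * b x * c x) Ω := by
  have := hb.integrable_mul (hc.mul ha (r := 2))
  exact this.congr (ae_of_all _ fun x => by simp only [Pi.mul_apply]; ring)

/-- The square of a test function as an element of `H¹(Ω)`. -/
lemma exists_h1_sq {η : Plane → ℝ} (hη : IsTest Ω η) :
    ∃ G : H1 Ω, ∀ i, h1Grad G i =ᵐ[volume.restrict Ω] fun x => 2 * (pd i η x * η x) := by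
  have h2 : IsTest Ω fun x => η x * η x := hη.smooth_mul hη.smooth
  obtain ⟨G, -, hG⟩ := exists_h1 h2.memLp h2.memLp_pd h2.isWeakGrad
  refine ⟨G, fun i => (hG i).trans (ae_of_all _ fun x => ?_)⟩
  rw [pd_mul i (hη.differentiable x) (hη.differentiable x)]
  ring

/-- `∫ (v·∇)w w = 0` for divergence free `v`. -/
lemma sum_integral_convection_eq_zero (hΩ : IsOpen Ω) (hb : Bornology.IsBounded Ω) (v : Vdiv Ω)
    {w : H1 Ω} (hw : w ∈ H10 Ω) :
    ∑ i, ∫ x in Ω, vFn v i x * h1Grad w i x * h1Fn w x = 0 := by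
  -- `L i` is multiplication by `vᵢ`. It turns the cubic integral into inner products continuous in
  -- `w`, so test functions suffice.
  choose L hL using fun i => exists_mulCLM hΩ hb (vFn_memLp_four hΩ hb v i)
  have heq : ∀ w : H10 Ω, ∀ i, inner ℝ (h1Grad w.1 i) (L i w)
      = ∫ x in Ω, vFn v i x * h1Grad w.1 i x * h1Fn w.1 x := fun w i => by
    rw [l2_inner_eq_of_ae (ae_eq_refl _) (hL i w)]
    exact integral_congr_ae (ae_of_all _ fun x => by ring)
  -- Here `2w∇w = ∇(w²)` is a gradient, hence orthogonal to `v`.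
  have htest : ∀ w : H10 Ω, w.1 ∈ testSet Ω → ∑ i, inner ℝ (h1Grad w.1 i) (L i w) = 0 := by
    rintro w ⟨η, hη, hwη⟩
    obtain ⟨G, hG⟩ := exists_h1_sq hη
    have h0 := sum_inner_h1Grad_vFn hΩ hb.measure_lt_top.ne G v
    have : ∀ i, inner ℝ (h1Grad G i) (vFn v i) = 2 * inner ℝ (h1Grad w.1 i) (L i w) := fun i => by
      rw [heq, l2_inner_eq_of_ae (hG i) (ae_eq_refl _), ← integral_const_mul]
      refine integral_congr_ae ?_
      filter_upwards [hwη, h1Grad_of_test hΩ hb.measure_lt_top.ne hη hwη i] with x h1 h2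
      rw [h1, h2]
      ring
    rw [Finset.sum_congr rfl fun i _ => this i, ← Finset.mul_sum] at h0
    linarith
  rw [← Finset.sum_congr rfl fun i _ => heq ⟨w, hw⟩ i]
  obtain ⟨g, hg, hlim⟩ := mem_closure_iff_seq_limit.1 (mem_H10_iff.1 hw)
  let g' : ℕ → H10 Ω := fun n => ⟨g n, testSet_subset_H10 (hg n)⟩
  have hlim' : Tendsto g' atTop (𝓝 ⟨w, hw⟩) := tendsto_subtype_rng.2 hlim
  have hc : Continuous fun w : H10 Ω => ∑ i, inner ℝ (h1Grad w.1 i) (L i w) :=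
    continuous_finsetSum _ fun i _ =>
      ((h1GradL Ω i).continuous.comp continuous_subtype_val).inner (L i).continuous
  refine tendsto_nhds_unique ((hc.tendsto ⟨w, hw⟩).comp hlim') ?_
  refine tendsto_const_nhds.congr fun n => ?_
  exact (htest (g' n) (hg n)).symm

end Sobolev

/-! ### Estimates for divergence free fields -/

section Vdiv

variable {Ω : Set Plane}

/-- The components of a field, as a continuous linear map. -/
def vCompL (Ω : Set Plane) (j : Fin 2) : Vdiv Ω →L[ℝ] H1 Ω :=
  (PiLp.proj 2 (fun _ : Fin 2 => H1 Ω) j : PiLp 2 (fun _ : Fin 2 => H1 Ω) →L[ℝ] H1 Ω).comp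
    (vdivSub Ω).subtypeL

lemma continuous_vFn (j : Fin 2) : Continuous fun v : Vdiv Ω => vFn v j :=
  (h1FnL Ω).continuous.comp (vCompL Ω j).continuous

lemma continuous_vPd (i j : Fin 2) : Continuous fun v : Vdiv Ω => vPd v i j :=
  (h1GradL Ω i).continuous.comp (vCompL Ω j).continuous

lemma vdiv_norm_sq (v : Vdiv Ω) :
    ‖v‖ ^ 2 = ∑ j, (‖vFn v j‖ ^ 2 + ∑ i, ‖vPd v i j‖ ^ 2) := by
  have h1 : ‖v‖ = ‖v.1‖ := rfl
  rw [h1, PiLp.norm_sq_eq_of_L2]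
  exact Finset.sum_congr rfl fun j _ => h1_norm_sq _

lemma vL2_norm_sq (v : Vdiv Ω) : ‖vL2 v‖ ^ 2 = ∑ j, ‖vFn v j‖ ^ 2 := by
  rw [PiLp.norm_sq_eq_of_L2]
  rfl

/-- The inclusion of `V_div` into `L²(Ω)²`. -/
def vL2L (Ω : Set Plane) : Vdiv Ω →L[ℝ] L2Vec Ω :=
  LinearMap.mkContinuous ⟨⟨vL2, fun _ _ => rfl⟩, fun _ _ => rfl⟩ 1 fun v => by
    rw [one_mul]
    refine le_of_sq_le_sq ?_ (norm_nonneg _)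
    change ‖vL2 v‖ ^ 2 ≤ _
    rw [vL2_norm_sq, vdiv_norm_sq]
    exact Finset.sum_le_sum fun j _ =>
      le_add_of_nonneg_right (Finset.sum_nonneg fun i _ => sq_nonneg _)

lemma exists_poincare_vdiv (hΩ : IsOpen Ω) (hb : Bornology.IsBounded Ω) :
    ∃ P : ℝ, 0 ≤ P ∧ ∀ v : Vdiv Ω, ∑ j, ‖vFn v j‖ ^ 2 ≤ P * ∑ i, ∑ j, ‖vPd v i j‖ ^ 2 := by
  obtain ⟨C, hC0, hC⟩ := exists_poincare hΩ hb
  refine ⟨C ^ 2 * 2, by positivity, fun v => ?_⟩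
  rw [Finset.sum_comm, Finset.mul_sum]
  refine Finset.sum_le_sum fun j _ => ?_
  have h1 : ‖vFn v j‖ ≤ C * ∑ i, ‖vPd v i j‖ := hC _ (v.2.1 j)
  calc ‖vFn v j‖ ^ 2 ≤ (C * ∑ i, ‖vPd v i j‖) ^ 2 := pow_le_pow_left₀ (norm_nonneg _) h1 2
    _ ≤ C ^ 2 * 2 * ∑ i, ‖vPd v i j‖ ^ 2 := by
      rw [mul_pow, mul_assoc]
      refine mul_le_mul_of_nonneg_left ?_ (sq_nonneg C)
      simp only [Fin.sum_univ_two]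
      nlinarith [sq_nonneg (‖vPd v 0 j‖ - ‖vPd v 1 j‖)]

lemma memLp_bdd_mul {r g : Plane → ℝ} {M : ℝ} (mr : Measurable r)
    (br : ∀ᵐ x ∂(volume.restrict Ω), |r x| ≤ M) (hg : MemLp g 2 (volume.restrict Ω)) :
    MemLp (fun x => r x * g x) 2 (volume.restrict Ω) :=
  hg.mul (memLp_top_of_bound mr.aestronglyMeasurable M br) (r := 2)

/-- Young's inequality `rf ≤ κf² + r²/(4κ)` under the integral; `κ` stays free so that viscosity can
absorb the first term. -/
lemma integral_bdd_mul_le (hfin : volume Ω ≠ ⊤) {r : Plane → ℝ} {M : ℝ} (mr : Measurable r)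
    (br : ∀ᵐ x ∂(volume.restrict Ω), |r x| ≤ M) (f : L2 Ω) {κ : ℝ} (hκ : 0 < κ) :
    ∫ x in Ω, r x * f x ≤ κ * ‖f‖ ^ 2 + M ^ 2 / (4 * κ) * volume.real Ω := by
  have : IsFiniteMeasure (volume.restrict Ω) := ⟨by simpa using hfin.lt_top⟩
  have e : ‖f‖ ^ 2 = ∫ x in Ω, f x ^ 2 := by
    rw [← real_inner_self_eq_norm_sq, l2_inner_eq]
    simp only [sq]
  have i2 : IntegrableOn (fun x => f x ^ 2) Ω := (Lp.memLp f).integrable_sq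
  have e2 : κ * ‖f‖ ^ 2 + M ^ 2 / (4 * κ) * volume.real Ω
      = ∫ x in Ω, (κ * f x ^ 2 + M ^ 2 / (4 * κ)) := by
    rw [integral_add (i2.const_mul κ) (integrable_const _), integral_const_mul, ← e]
    simp [mul_comm]
  rw [e2]
  refine integral_mono_ae ((memLp_bdd_mul mr br (Lp.memLp f)).integrable (by norm_num))
    ((i2.const_mul κ).add (integrable_const _)) ?_
  filter_upwards [br] with x hx
  have h1 : r x * f x ≤ κ * f x ^ 2 + r x ^ 2 / (4 * κ) := by
    have : κ * f x ^ 2 + r x ^ 2 / (4 * κ) - r x * f x = κ * (f x - r x / (2 * κ)) ^ 2 := by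
      field_simp
      ring
    nlinarith [mul_nonneg hκ.le (sq_nonneg (f x - r x / (2 * κ)))]
  have h2 : r x ^ 2 ≤ M ^ 2 := sq_le_sq' (by linarith [(abs_le.1 hx).1]) (abs_le.1 hx).2
  have h3 : r x ^ 2 / (4 * κ) ≤ M ^ 2 / (4 * κ) := by gcongr
  linarith

/-- Since the field is divergence free, no derivative of the order parameter enters the work done
by the capillary force. -/
lemma integral_force_eq (hΩ : IsOpen Ω) (hfin : volume Ω ≠ ⊤) {J : Plane → ℝ}
    {DJ : Fin 2 → Plane → ℝ} (hJ : KernelAssumption Ω J DJ) {Φ : H1 Ω}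
    (hφ : ∀ᵐ x ∂(volume.restrict Ω), |h1Fn Φ x| ≤ 1) (v : Vdiv Ω) :
    (∫ x in Ω, ∑ i, (kerA Ω J x * h1Fn Φ x - conv J (h1Fn Φ) x) * h1Grad Φ i x * vFn v i x)
      = ∑ i, ∫ x in Ω, (h1Fn Φ x * conv (DJ i) (h1Fn Φ) x
          - 1 / 2 * (h1Fn Φ x * (h1Fn Φ x * kerA Ω (DJ i) x))) * vFn v i x := by
  have : IsFiniteMeasure (volume.restrict Ω) := ⟨by simpa using hfin.lt_top⟩
  set φ := h1Fn Φ with hφdef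
  have mφ : Measurable φ := (Lp.stronglyMeasurable φ).measurable
  have hin := ae_restrict_mem (μ := volume) hΩ.measurableSet
  have b1 : ∀ᵐ x ∂(volume.restrict Ω), |(fun _ => (1 : ℝ)) x| ≤ 1 := ae_of_all _ fun x => by simp
  have ma : Measurable (kerA Ω J) := by
    rw [kerA_eq_kerConv]; exact measurable_kerConv hJ.measurable measurable_const
  have mai : ∀ i, Measurable (kerA Ω (DJ i)) := fun i => by
    rw [kerA_eq_kerConv]; exact measurable_kerConv (hJ.measurable_grad i) measurable_const
  have mk : Measurable (conv J φ) := measurable_kerConv hJ.measurable mφ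
  have mki : ∀ i, Measurable (conv (DJ i) φ) := fun i =>
    measurable_kerConv (hJ.measurable_grad i) mφ
  have ba : ∀ᵐ x ∂(volume.restrict Ω), |kerA Ω J x| ≤ (aSup Ω J).toReal := by
    rw [kerA_eq_kerConv]
    filter_upwards [hin] with x hx
    exact abs_kerConv_le hJ.measurable hJ.aSup_lt_top lintegral_le_aSup b1 hx
  have bai : ∀ i, ∀ᵐ x ∂(volume.restrict Ω), |kerA Ω (DJ i) x| ≤ (bSup Ω DJ).toReal := fun i => by
    rw [kerA_eq_kerConv]
    filter_upwards [hin] with x hx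
    exact abs_kerConv_le (hJ.measurable_grad i) hJ.bSup_lt_top (lintegral_le_bSup i) b1 hx
  have bk : ∀ᵐ x ∂(volume.restrict Ω), |conv J φ x| ≤ (aSup Ω J).toReal := by
    filter_upwards [hin] with x hx
    exact abs_kerConv_le hJ.measurable hJ.aSup_lt_top lintegral_le_aSup hφ hx
  have bki : ∀ i, ∀ᵐ x ∂(volume.restrict Ω), |conv (DJ i) φ x| ≤ (bSup Ω DJ).toReal := fun i => by
    filter_upwards [hin] with x hx
    exact abs_kerConv_le (hJ.measurable_grad i) hJ.bSup_lt_top (lintegral_le_bSup i) hφ hx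
  have memb : ∀ {r : Plane → ℝ} {M : ℝ}, Measurable r →
      (∀ᵐ x ∂(volume.restrict Ω), |r x| ≤ M) → MemLp r 2 (volume.restrict Ω) :=
    fun mr br => MemLp.of_bound mr.aestronglyMeasurable _ br
  have int2 : ∀ {r : Plane → ℝ}, MemLp r 2 (volume.restrict Ω) → IntegrableOn r Ω :=
    fun hr => hr.integrable (by norm_num)
  have wφ : IsWeakGrad Ω φ fun i => h1Grad Φ i := h1_isWeakGrad Φ
  have gφ : ∀ i, MemLp (h1Grad Φ i) 2 (volume.restrict Ω) := fun i => Lp.memLp _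
  have wa : IsWeakGrad Ω (kerA Ω J) fun i => kerA Ω (DJ i) := by
    simp only [kerA_eq_kerConv]
    exact hJ.isWeakGrad_kerConv hΩ.measurableSet hfin measurable_const b1
  have wk : IsWeakGrad Ω (conv J φ) fun i => conv (DJ i) φ :=
    hJ.isWeakGrad_kerConv hΩ.measurableSet hfin mφ hφ
  -- `a φ` and `a φ²`
  have waφ := wφ.mul hΩ hfin wa mφ ma hφ ba (fun i => int2 (gφ i))
    (fun i => int2 (memb (mai i) (bai i)))
  have gaφ : ∀ i, MemLp (fun x => φ x * kerA Ω (DJ i) x + kerA Ω J x * h1Grad Φ i x) 2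
      (volume.restrict Ω) := fun i =>
    (memLp_bdd_mul mφ hφ (memb (mai i) (bai i))).add (memLp_bdd_mul ma ba (gφ i))
  have baφ : ∀ᵐ x ∂(volume.restrict Ω), |φ x * kerA Ω J x| ≤ 1 * (aSup Ω J).toReal := by
    filter_upwards [hφ, ba] with x h1 h2
    rw [abs_mul]
    exact mul_le_mul h1 h2 (abs_nonneg _) zero_le_one
  have waφφ := wφ.mul hΩ hfin waφ mφ (mφ.mul ma) hφ baφ (fun i => int2 (gφ i))
    (fun i => int2 (gaφ i))
  obtain ⟨G, -, hG⟩ := exists_h1 (memLp_bdd_mul mφ hφ (memb (mφ.mul ma) baφ))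
    (fun i => (memLp_bdd_mul mφ hφ (gaφ i)).add (memLp_bdd_mul (mφ.mul ma) baφ (gφ i))) waφφ
  -- `(J ∗ φ) φ`
  have wkφ := wφ.mul hΩ hfin wk mφ mk hφ bk (fun i => int2 (gφ i))
    (fun i => int2 (memb (mki i) (bki i)))
  obtain ⟨K, -, hK⟩ := exists_h1 (memLp_bdd_mul mφ hφ (memb mk bk))
    (fun i => (memLp_bdd_mul mφ hφ (memb (mki i) (bki i))).add (memLp_bdd_mul mk bk (gφ i))) wkφ
  have oG := sum_inner_h1Grad_vFn hΩ hfin G v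
  have oK := sum_inner_h1Grad_vFn hΩ hfin K v
  have vmem : ∀ i, MemLp (vFn v i) 2 (volume.restrict Ω) := fun i => Lp.memLp _
  have iforce : ∀ i, IntegrableOn (fun x =>
      (kerA Ω J x * φ x - conv J φ x) * h1Grad Φ i x * vFn v i x) Ω := fun i => by
    have m1 : MemLp (fun x => (kerA Ω J x * φ x - conv J φ x) * h1Grad Φ i x) 2
        (volume.restrict Ω) := by
      refine ((memLp_bdd_mul (mφ.mul ma) baφ (gφ i)).sub
        (memLp_bdd_mul mk bk (gφ i))).ae_eq (ae_of_all _ fun x => ?_)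
      simp only [Pi.sub_apply, Pi.mul_apply]
      ring
    exact m1.integrable_mul (vmem i)
  rw [integral_finsetSum _ fun i _ => iforce i]
  have irhs : ∀ i, IntegrableOn (fun x => (φ x * conv (DJ i) φ x
      - 1 / 2 * (φ x * (φ x * kerA Ω (DJ i) x))) * vFn v i x) Ω := fun i => by
    have m1 : MemLp (fun x => φ x * conv (DJ i) φ x
        - 1 / 2 * (φ x * (φ x * kerA Ω (DJ i) x))) 2 (volume.restrict Ω) :=
      (memLp_bdd_mul mφ hφ (memb (mki i) (bki i))).sub
        ((memLp_bdd_mul mφ hφ (memLp_bdd_mul mφ hφ (memb (mai i) (bai i)))).const_mul (1 / 2))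
    exact m1.integrable_mul (vmem i)
  -- With `G = aφ²` and `K = φ (J∗φ)`, the product rule gives `(aφ - J∗φ)∇φ = ½∇G - ∇K + φ (∇J∗φ) -
  -- ½φ²∇a`. Summed over `i`, the gradients of `G` and `K` drop out against `v`.
  have hid : ∀ i, (∫ x in Ω, (kerA Ω J x * φ x - conv J φ x) * h1Grad Φ i x * vFn v i x)
      - (∫ x in Ω, (φ x * conv (DJ i) φ x
          - 1 / 2 * (φ x * (φ x * kerA Ω (DJ i) x))) * vFn v i x)
      = 1 / 2 * inner ℝ (h1Grad G i) (vFn v i) - inner ℝ (h1Grad K i) (vFn v i) := fun i => by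
    have i1 : IntegrableOn (fun x => h1Grad G i x * vFn v i x) Ω :=
      (Lp.memLp (h1Grad G i)).integrable_mul (vmem i)
    have i2 : IntegrableOn (fun x => h1Grad K i x * vFn v i x) Ω :=
      (Lp.memLp (h1Grad K i)).integrable_mul (vmem i)
    rw [← integral_sub (iforce i) (irhs i), l2_inner_eq, l2_inner_eq, ← integral_const_mul,
      ← integral_sub (i1.const_mul _) i2]
    refine integral_congr_ae ?_
    filter_upwards [hG i, hK i] with x h1 h2
    rw [h1, h2]
    simp only [Pi.add_apply, Pi.mul_apply]
    ring
  have hsum := Finset.sum_congr rfl fun i (_ : i ∈ (Finset.univ : Finset (Fin 2))) => hid i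
  rw [Finset.sum_sub_distrib, Finset.sum_sub_distrib, ← Finset.mul_sum, oG, oK] at hsum
  linarith

/-- Once `∇φ` is gone, each component of the force is bounded by `b + b/2 ≤ 2b` with `b = sup
∫|∇J|`, and Young's inequality applies. -/
lemma integral_force_le (hΩ : IsOpen Ω) (hfin : volume Ω ≠ ⊤) {J : Plane → ℝ}
    {DJ : Fin 2 → Plane → ℝ} (hJ : KernelAssumption Ω J DJ) {Φ : H1 Ω}
    (hφ : ∀ᵐ x ∂(volume.restrict Ω), |h1Fn Φ x| ≤ 1) (v : Vdiv Ω) {κ : ℝ} (hκ : 0 < κ) :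
    (∫ x in Ω, ∑ i, (kerA Ω J x * h1Fn Φ x - conv J (h1Fn Φ) x) * h1Grad Φ i x * vFn v i x)
      ≤ ∑ i, (κ * ‖vFn v i‖ ^ 2 + (2 * (bSup Ω DJ).toReal) ^ 2 / (4 * κ) * volume.real Ω) := by
  rw [integral_force_eq hΩ hfin hJ hφ v]
  refine Finset.sum_le_sum fun i _ => integral_bdd_mul_le hfin ?_ ?_ _ hκ
  · have mφ : Measurable (h1Fn Φ) := (Lp.stronglyMeasurable _).measurable
    have mk : Measurable (conv (DJ i) (h1Fn Φ)) := measurable_kerConv (hJ.measurable_grad i) mφ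
    have ma : Measurable (kerA Ω (DJ i)) := by
      rw [kerA_eq_kerConv]; exact measurable_kerConv (hJ.measurable_grad i) measurable_const
    exact (mφ.mul mk).sub ((mφ.mul (mφ.mul ma)).const_mul _)
  · filter_upwards [hφ, ae_restrict_mem hΩ.measurableSet] with x h1 hx
    have h2 : |conv (DJ i) (h1Fn Φ) x| ≤ (bSup Ω DJ).toReal :=
      abs_kerConv_le (hJ.measurable_grad i) hJ.bSup_lt_top (lintegral_le_bSup i) hφ hx
    have h3 : |kerA Ω (DJ i) x| ≤ (bSup Ω DJ).toReal := by
      rw [kerA_eq_kerConv]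
      exact abs_kerConv_le (hJ.measurable_grad i) hJ.bSup_lt_top (lintegral_le_bSup i)
        (ae_of_all _ fun x => by simp) hx
    have h4 : |h1Fn Φ x * conv (DJ i) (h1Fn Φ) x| ≤ (bSup Ω DJ).toReal := by
      rw [abs_mul]
      exact (mul_le_of_le_one_left (abs_nonneg _) h1).trans h2
    have h5 : |h1Fn Φ x * (h1Fn Φ x * kerA Ω (DJ i) x)| ≤ (bSup Ω DJ).toReal := by
      rw [abs_mul, abs_mul]
      exact (mul_le_of_le_one_left (by positivity) h1).trans
        ((mul_le_of_le_one_left (abs_nonneg _) h1).trans h3)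
    rw [abs_le] at h4 h5 ⊢
    constructor <;> linarith [h4.1, h4.2, h5.1, h5.2, ENNReal.toReal_nonneg (a := bSup Ω DJ)]

end Vdiv

/-! ### The energy inequality for weak solutions -/

/-- If a property holds at almost every time for each fixed vector, and is closed in the vector,
then it holds at almost every time along a strongly measurable path. -/
lemma ae_forall_apply_of_isClosed {α E : Type*} [MeasurableSpace α] {μ : Measure α}
    [TopologicalSpace E] [TopologicalSpace.PseudoMetrizableSpace E] {U : α → E}
    (hU : AEStronglyMeasurable U μ) {P : α → E → Prop} (hP : ∀ v, ∀ᵐ t ∂μ, P t v)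
    (hc : ∀ᵐ t ∂μ, IsClosed {v | P t v}) : ∀ᵐ t ∂μ, P t (U t) := by
  -- Almost all values of `U` lie in the closure of a countable set `c`; the countably many
  -- exceptional sets together are null, and closedness passes from `c` to `U t`.
  obtain ⟨s, ⟨c, hcc, hsc⟩, hs⟩ := hU.isSeparable_ae_range
  filter_upwards [hc, hs, (ae_ball_iff hcc).2 fun v _ => hP v] with t h1 h2 h3
  exact closure_minimal (fun v hv => h3 v hv) h1 (hsc h2)

section Energy

variable {Ω : Set Plane}

lemma integral_sum_sum_vPd_mul (U v : Vdiv Ω) :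
    (∫ x in Ω, ∑ i, ∑ j, vPd U i j x * vPd v i j x)
      = ∑ i, ∑ j, inner ℝ (vPd U i j) (vPd v i j) := by
  have hi : ∀ i j, IntegrableOn (fun x => vPd U i j x * vPd v i j x) Ω := fun i j =>
    (Lp.memLp (vPd U i j)).integrable_mul (Lp.memLp (vPd v i j))
  rw [integral_finsetSum _ fun i _ => integrable_finsetSum _ fun j _ => hi i j]
  refine Finset.sum_congr rfl fun i _ => ?_
  rw [integral_finsetSum _ fun j _ => hi i j]
  exact Finset.sum_congr rfl fun j _ => (l2_inner_eq _ _).symm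

lemma integral_convection_eq_sum (hΩ : IsOpen Ω) (hb : Bornology.IsBounded Ω) (U v : Vdiv Ω) :
    (∫ x in Ω, ∑ i, ∑ j, vFn U i x * vPd U i j x * vFn v j x)
      = ∑ j, ∑ i, ∫ x in Ω, vFn U i x * vPd U i j x * vFn v j x := by
  have hi : ∀ i j, IntegrableOn (fun x => vFn U i x * vPd U i j x * vFn v j x) Ω := fun i j =>
    integrable_trilinear (vFn_memLp_four hΩ hb U i) (Lp.memLp _) (vFn_memLp_four hΩ hb v j)
  rw [Finset.sum_comm, integral_finsetSum _ fun i _ => integrable_finsetSum _ fun j _ => hi i j]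
  exact Finset.sum_congr rfl fun i _ => integral_finsetSum _ fun j _ => hi i j

/-- Multiplication by `Uᵢ ∈ L⁴` maps `H¹₀` continuously to `L²`, where the product is paired with
`∂ᵢUⱼ`. Together with `continuous_force`, this makes the momentum equation a closed condition on the
test field. -/
lemma continuous_convection (hΩ : IsOpen Ω) (hb : Bornology.IsBounded Ω) (U : Vdiv Ω) :
    Continuous fun v : Vdiv Ω => ∫ x in Ω, ∑ i, ∑ j, vFn U i x * vPd U i j x * vFn v j x := by
  choose L hL using fun i => exists_mulCLM hΩ hb (vFn_memLp_four hΩ hb U i)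
  have hc : Continuous fun v : Vdiv Ω =>
      ∑ j, ∑ i, inner ℝ (vPd U i j) (L i ⟨v.1 j, v.2.1 j⟩) := by
    refine continuous_finsetSum _ fun j _ => continuous_finsetSum _ fun i _ =>
      continuous_const.inner ((L i).continuous.comp ?_)
    exact Continuous.subtype_mk (vCompL Ω j).continuous fun v => v.2.1 j
  refine hc.congr fun v => ?_
  rw [integral_convection_eq_sum hΩ hb]
  refine Finset.sum_congr rfl fun j _ => Finset.sum_congr rfl fun i _ => ?_
  rw [l2_inner_eq_of_ae (ae_eq_refl _) (hL i ⟨v.1 j, v.2.1 j⟩)]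
  refine integral_congr_ae (ae_of_all _ fun x => ?_)
  simp only [vFn]
  ring

lemma continuous_force (hΩ : IsOpen Ω) {J : Plane → ℝ}
    {DJ : Fin 2 → Plane → ℝ} (hJ : KernelAssumption Ω J DJ) {Φ : H1 Ω}
    (hφ : ∀ᵐ x ∂(volume.restrict Ω), |h1Fn Φ x| ≤ 1) :
    Continuous fun v : Vdiv Ω => ∫ x in Ω, ∑ i,
      (kerA Ω J x * h1Fn Φ x - conv J (h1Fn Φ) x) * h1Grad Φ i x * vFn v i x := by
  have mφ : Measurable (h1Fn Φ) := (Lp.stronglyMeasurable _).measurable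
  have ma : Measurable (kerA Ω J) := by
    rw [kerA_eq_kerConv]; exact measurable_kerConv hJ.measurable measurable_const
  have mr : Measurable fun x => kerA Ω J x * h1Fn Φ x - conv J (h1Fn Φ) x :=
    (ma.mul mφ).sub (measurable_kerConv hJ.measurable mφ)
  have br : ∀ᵐ x ∂(volume.restrict Ω), |kerA Ω J x * h1Fn Φ x - conv J (h1Fn Φ) x|
      ≤ 2 * (aSup Ω J).toReal := by
    filter_upwards [hφ, ae_restrict_mem hΩ.measurableSet] with x h1 hx
    have h2 : |conv J (h1Fn Φ) x| ≤ (aSup Ω J).toReal :=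
      abs_kerConv_le hJ.measurable hJ.aSup_lt_top lintegral_le_aSup hφ hx
    have h3 : |kerA Ω J x| ≤ (aSup Ω J).toReal := by
      rw [kerA_eq_kerConv]
      exact abs_kerConv_le hJ.measurable hJ.aSup_lt_top lintegral_le_aSup
        (ae_of_all _ fun x => by simp) hx
    have h4 : |kerA Ω J x * h1Fn Φ x| ≤ (aSup Ω J).toReal := by
      rw [abs_mul]
      exact (mul_le_of_le_one_right (abs_nonneg _) h1).trans h3
    rw [abs_le] at h2 h4 ⊢
    constructor <;> linarith [h2.1, h2.2, h4.1, h4.2]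
  have hm : ∀ i, MemLp (fun x => (kerA Ω J x * h1Fn Φ x - conv J (h1Fn Φ) x) * h1Grad Φ i x) 2
      (volume.restrict Ω) := fun i => memLp_bdd_mul mr br (Lp.memLp _)
  have hc : Continuous fun v : Vdiv Ω => ∑ i, inner ℝ ((hm i).toLp _) (vFn v i) :=
    continuous_finsetSum _ fun i _ => continuous_const.inner (continuous_vFn i)
  refine hc.congr fun v => ?_
  have hi : ∀ i, IntegrableOn (fun x => (kerA Ω J x * h1Fn Φ x - conv J (h1Fn Φ) x)
      * h1Grad Φ i x * vFn v i x) Ω := fun i => (hm i).integrable_mul (Lp.memLp (vFn v i))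
  rw [integral_finsetSum _ fun i _ => hi i]
  exact Finset.sum_congr rfl fun i _ => l2_inner_eq_of_ae (hm i).coeFn_toLp (ae_eq_refl _)

/-- The decay rate and the constant of the energy inequality: for divergence free `v` and any
admissible order parameter, dissipation dominates the forces. -/
lemma exists_dissipation (hΩ : IsOpen Ω) (hb : Bornology.IsBounded Ω) {ν : ℝ} (hν : 0 < ν)
    {J : Plane → ℝ} {DJ : Fin 2 → Plane → ℝ} (hJ : KernelAssumption Ω J DJ)
    (h : StrongDual ℝ (Vdiv Ω)) :
    ∃ η > (0 : ℝ), ∃ C ≥ (0 : ℝ), ∀ (v : Vdiv Ω) (Φ : H1 Ω),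
      (∀ᵐ x ∂(volume.restrict Ω), |h1Fn Φ x| ≤ 1) → ∀ d : ℝ,
      d + ν * (∫ x in Ω, ∑ i, ∑ j, vPd v i j x * vPd v i j x)
        + (∫ x in Ω, ∑ i, ∑ j, vFn v i x * vPd v i j x * vFn v j x)
        = (∫ x in Ω, ∑ i, (kerA Ω J x * h1Fn Φ x - conv J (h1Fn Φ) x)
            * h1Grad Φ i x * vFn v i x) + h v →
      2 * d ≤ -η * ‖vL2 v‖ ^ 2 + C := by
  obtain ⟨P, hP0, hP⟩ := exists_poincare_vdiv hΩ hb
  have hfin : volume Ω ≠ ⊤ := hb.measure_lt_top.ne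
  -- Write `S = ‖∇v‖²` and `R = ‖v‖²` in `L²`, so `R ≤ PS`. Young's inequality for the force and for
  -- `h` costs `4κR + 2κS` in `2d`, and the decay rate `η = 4κ` asks for another `4κR`. This `κ`
  -- makes the gain `2νS = 8κPS + 8κS`, which covers both.
  set κ : ℝ := ν / (4 * (P + 1)) with hκ
  have hκ0 : 0 < κ := by positivity
  have hκP : κ * (P + 1) = ν / 4 := by rw [hκ]; field_simp
  set K : ℝ := (2 * (bSup Ω DJ).toReal) ^ 2 / (4 * κ) * volume.real Ω
  set E : ℝ := ‖h‖ ^ 2 / (4 * κ)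
  have hK0 : 0 ≤ K := by positivity
  have hE0 : 0 ≤ E := by positivity
  refine ⟨4 * κ, by positivity, 2 * (2 * K + E), by positivity, fun v Φ hφ d hd => ?_⟩
  have hconv : (∫ x in Ω, ∑ i, ∑ j, vFn v i x * vPd v i j x * vFn v j x) = 0 := by
    rw [integral_convection_eq_sum hΩ hb]
    exact Finset.sum_eq_zero fun j _ => sum_integral_convection_eq_zero hΩ hb v (v.2.1 j)
  rw [hconv, integral_sum_sum_vPd_mul] at hd
  simp only [real_inner_self_eq_norm_sq] at hd
  have hforce := integral_force_le hΩ hfin hJ hφ v hκ0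
  rw [Finset.sum_add_distrib, ← Finset.mul_sum, Finset.sum_const, Finset.card_univ,
    Fintype.card_fin, two_smul] at hforce
  have hPv := hP v
  have hn := vdiv_norm_sq v
  rw [Finset.sum_add_distrib, Finset.sum_comm (f := fun j i => ‖vPd v i j‖ ^ 2)] at hn
  rw [vL2_norm_sq]
  set S := ∑ i, ∑ j, ‖vPd v i j‖ ^ 2
  set R := ∑ j, ‖vFn v j‖ ^ 2
  have hh : h v ≤ κ * ‖v‖ ^ 2 + E := by
    have h1 : h v ≤ ‖h‖ * ‖v‖ := (le_abs_self _).trans (h.le_opNorm v)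
    have h2 : κ * ‖v‖ ^ 2 + E - ‖h‖ * ‖v‖ = κ * (‖v‖ - ‖h‖ / (2 * κ)) ^ 2 := by
      simp only [E]
      field_simp
      ring
    nlinarith [mul_nonneg hκ0.le (sq_nonneg (‖v‖ - ‖h‖ / (2 * κ)))]
  have hS0 : 0 ≤ S := Finset.sum_nonneg fun i _ => Finset.sum_nonneg fun j _ => sq_nonneg _
  have hR : κ * R ≤ κ * P * S := by
    rw [mul_assoc]; exact mul_le_mul_of_nonneg_left hPv hκ0.le
  have hνS : ν * S = 4 * (κ * P * S) + 4 * (κ * S) := by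
    have : ν = 4 * (κ * (P + 1)) := by rw [hκP]; ring
    rw [this]; ring
  have hκS : 0 ≤ κ * S := mul_nonneg hκ0.le hS0
  rw [hn, mul_add] at hh
  linarith

end Energy

/-! ### From weak solutions to the velocity bound. -/

/-- The energy identity translates functions in time, so they must live on all of `ℝ`. Passing
through `Lp` also provides strongly measurable representatives. -/
lemma exists_Lp_extend_zero {α E : Type*} [MeasurableSpace α] {μ : Measure α}
    [NormedAddCommGroup E] {p : ℝ≥0∞} {S : Set α} (hS : MeasurableSet S) {f : α → E}
    (hf : MemLp f p (μ.restrict S)) :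
    ∃ X : Lp E p μ, (∀ᵐ t ∂μ, t ∈ S → X t = f t) ∧ ∀ᵐ t ∂μ, t ∉ S → X t = 0 := by
  have hm : MemLp (S.indicator f) p μ := (memLp_indicator_iff_restrict hS).2 hf
  refine ⟨hm.toLp _, ?_, ?_⟩ <;> filter_upwards [hm.coeFn_toLp] with t ht hmem
  · rw [ht, indicator_of_mem hmem]
  · rw [ht, indicator_of_notMem hmem]

/-- A function in `L²(0,T;V)` with weak derivative in `L²(0,T;V')` gives a `GelfandPath`. -/
lemma GelfandPath.exists_of_weakDeriv {V H : Type*} [NormedAddCommGroup V] [NormedSpace ℝ V]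
    [NormedAddCommGroup H] [InnerProductSpace ℝ H] {ι : V →L[ℝ] H} {T : ℝ} {u : ℝ → H}
    {U : ℝ → V} {u' : ℝ → StrongDual ℝ V}
    (hu : ∀ w : H, ContinuousOn (fun t => inner ℝ (u t) w) (Icc 0 T))
    (hU : MemLp U 2 (volume.restrict (Ioo 0 T))) (hu' : MemLp u' 2 (volume.restrict (Ioo 0 T)))
    (heq : ∀ᵐ t ∂(volume.restrict (Ioo 0 T)), ι (U t) = u t)
    (hd : ∀ χ : ℝ → ℝ, ContDiff ℝ ∞ χ → HasCompactSupport χ → tsupport χ ⊆ Ioo 0 T →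
      ∀ v : V, ∫ t in Ioo 0 T, deriv χ t * inner ℝ (u t) (ι v) = - ∫ t in Ioo 0 T, χ t * u' t v) :
    ∃ (X : ℝ → V) (W : ℝ → StrongDual ℝ V), GelfandPath ι T u X W ∧
      ∀ᵐ t, t ∈ Ioo 0 T → X t = U t ∧ W t = u' t := by
  obtain ⟨X, hX, -⟩ := exists_Lp_extend_zero measurableSet_Ioo hU
  obtain ⟨W, hW, hW0⟩ := exists_Lp_extend_zero measurableSet_Ioo hu'
  refine ⟨X, W, ⟨hu, Lp.stronglyMeasurable _, Lp.stronglyMeasurable _,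
    Lp.memLp _, Lp.memLp _, ?_, fun v s hs t ht => ?_⟩, by
    filter_upwards [hX, hW] with t h1 h2 hm using ⟨h1 hm, h2 hm⟩⟩
  · filter_upwards [hX, (ae_restrict_iff' measurableSet_Ioo).1 heq] with t h1 h2 hm
    rw [h1 hm, h2 hm]
  · have hi : Integrable fun r => W r v := by
      have h1 : IntegrableOn (fun r => u' r v) (Ioo 0 T) :=
        ((ContinuousLinearMap.apply ℝ ℝ v).comp_memLp' hu').integrable (by norm_num)
      refine ((integrable_indicator_iff measurableSet_Ioo).2 h1).congr ?_
      filter_upwards [hW, hW0] with r h2 h3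
      by_cases hm : r ∈ Ioo 0 T
      · rw [indicator_of_mem hm, h2 hm]
      · rw [indicator_of_notMem hm, h3 hm, zero_apply]
    refine sub_eq_intervalIntegral_of_weakDeriv (T := T) (hu (ι v)) hi
      (fun χ h1 h2 h3 => ?_) hs ht
    rw [hd χ h1 h2 h3 v, neg_inj]
    refine setIntegral_congr_ae measurableSet_Ioo ?_
    filter_upwards [hW] with r hr hm
    rw [hr hm]

/-- The energy inequality for the velocity. -/
lemma exists_velocity_bound {Ω : Set Plane} (hΩ : IsOpen Ω) (hb : Bornology.IsBounded Ω) {ν : ℝ}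
    (hν : 0 < ν) {J : Plane → ℝ} {DJ : Fin 2 → Plane → ℝ} (hJ : KernelAssumption Ω J DJ)
    (m F : ℝ → ℝ) (h : StrongDual ℝ (Vdiv Ω)) :
    ∃ η > (0 : ℝ), ∃ C ≥ (0 : ℝ), ∀ (T : ℝ) (u : ℝ → Gdiv Ω) (φ : ℝ → L2 Ω),
      IsWeakSol Ω ν J DJ m F h T u φ → ∀ t ∈ Ico 0 T,
        ‖u t‖ ^ 2 ≤ ‖u 0‖ ^ 2 * Real.exp (-η * t) + C := by
  obtain ⟨η, hη, C, hC, hdis⟩ := exists_dissipation hΩ hb hν hJ h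
  refine ⟨η, hη, C / η, by positivity, ?_⟩
  rintro T u φ ⟨U, Φ, u', φ', hs⟩ t ht
  obtain ⟨X, W, hG, hXW⟩ := GelfandPath.exists_of_weakDeriv (ι := vL2L Ω)
    (u := fun t => (u t : L2Vec Ω)) hs.u_weakCont hs.U_memLp hs.u'_memLp hs.u_eq hs.u_deriv
  refine hG.norm_sq_le hη hC ?_ ht
  have hadm : ∀ᵐ t ∂(volume.restrict (Ioo 0 T)),
      vL2 (U t) = u t ∧ h1Fn (Φ t) = φ t ∧ ∀ᵐ x ∂(volume.restrict Ω), |h1Fn (Φ t) x| ≤ 1 := by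
    filter_upwards [hs.u_eq, hs.φ_eq, hs.φ_abs_le] with t h1 h2 h3
    exact ⟨h1, h2, by rw [h2]; exact h3⟩
  have hcomp : ∀ t i, vL2 (U t) = u t → (u t : L2Vec Ω) i = vFn (U t) i := fun t i h1 => by
    rw [← h1]; rfl
  -- The null set of times in the weak formulation depends on the test field; this step is what
  -- permits testing with `U t` itself.
  have heq := ae_forall_apply_of_isClosed hs.U_memLp.1
    (P := fun t v => u' t v
      + ν * (∫ x in Ω, ∑ i, ∑ j, vPd (U t) i j x * vPd v i j x)
      + (∫ x in Ω, ∑ i, ∑ j, vFn (U t) i x * vPd (U t) i j x * vFn v j x)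
      = (∫ x in Ω, ∑ i, (kerA Ω J x * h1Fn (Φ t) x - conv J (h1Fn (Φ t)) x)
          * h1Grad (Φ t) i x * vFn v i x) + h v) (fun v => by
      filter_upwards [hs.eq_u v, hadm] with t h1 ⟨h2, h3, _⟩
      simp only [hcomp t _ h2] at h1
      rw [h3]
      exact h1) (by
      filter_upwards [hadm] with t ⟨_, _, h3⟩
      refine isClosed_eq (((u' t).continuous.add (continuous_const.mul ?_)).add
        (continuous_convection hΩ hb (U t))) ((continuous_force hΩ hJ h3).add h.continuous)
      simp only [integral_sum_sum_vPd_mul]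
      exact continuous_finsetSum _ fun i _ => continuous_finsetSum _ fun j _ =>
        continuous_const.inner (continuous_vPd i j))
  filter_upwards [(ae_restrict_iff' measurableSet_Ioo).1 heq,
    (ae_restrict_iff' measurableSet_Ioo).1 hadm, hXW] with s h1 h2 h3 hm
  rw [(h3 hm).1, (h3 hm).2, ← (h2 hm).1]
  exact hdis (U s) (Φ s) (h2 hm).2.2 _ (h1 hm)

/-! ### Bounds for the order parameter and in the phase space. -/

/-- The bound `|φ| ≤ 1` controls the norm of the order parameter at all times. -/
lemma IsWeakSol.norm_sq_le {Ω : Set Plane} (hfin : volume Ω ≠ ⊤) {ν : ℝ} {J : Plane → ℝ}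
    {DJ : Fin 2 → Plane → ℝ} {m F : ℝ → ℝ} {h : StrongDual ℝ (Vdiv Ω)} {T : ℝ}
    {u : ℝ → Gdiv Ω} {φ : ℝ → L2 Ω} (hs : IsWeakSol Ω ν J DJ m F h T u φ) {t : ℝ}
    (ht : t ∈ Ico 0 T) : ‖φ t‖ ^ 2 ≤ volume.real Ω := by
  obtain ⟨U, Φ, u', φ', hs⟩ := hs
  have : IsFiniteMeasure (volume.restrict Ω) := ⟨by simpa using hfin.lt_top⟩
  set N := volume.real Ω
  have hN : 0 ≤ N := measureReal_nonneg
  have hae : ∀ᵐ s ∂(volume.restrict (Ioo 0 T)), ‖φ s‖ ^ 2 ≤ N := by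
    filter_upwards [hs.φ_abs_le] with s h1
    rw [← real_inner_self_eq_norm_sq, l2_inner_eq]
    calc ∫ x in Ω, φ s x * φ s x ≤ ∫ _ in Ω, (1 : ℝ) := by
          refine integral_mono_ae ((Lp.memLp (φ s)).integrable_mul (Lp.memLp (φ s)))
            (integrable_const _) ?_
          filter_upwards [h1] with x hx
          rw [← sq, ← sq_abs]
          exact pow_le_one₀ (abs_nonneg _) hx
      _ = N := by simp [N]
  -- The bound holds only at almost every time. Weak continuity from the right, tested with `φ t`
  -- itself, carries it to every `t`, including `t = 0`: `(φ s, φ t) ≤ √N ‖φ t‖` at times `s`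
  -- arbitrarily close to `t`, hence at `s = t`.
  have hc : ContinuousWithinAt (fun s => inner ℝ (φ s) (φ t)) (Ioo t T) t :=
    (hs.φ_weakCont (φ t) t ⟨ht.1, ht.2.le⟩).mono fun s hs => ⟨ht.1.trans hs.1.le, hs.2.le⟩
  have hne : (𝓝[Ioo t T] t).NeBot := by
    rw [nhdsWithin_Ioo_eq_nhdsGT ht.2]; infer_instance
  have hfreq : ∃ᶠ s in 𝓝[Ioo t T] t, inner ℝ (φ s) (φ t) ≤ √N * ‖φ t‖ := by
    have hae' : ∀ᵐ s, s ∈ Ioo 0 T → inner ℝ (φ s) (φ t) ≤ √N * ‖φ t‖ := by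
      filter_upwards [(ae_restrict_iff' measurableSet_Ioo).1 hae] with s h1 hm
      refine (real_inner_le_norm _ _).trans (mul_le_mul_of_nonneg_right ?_ (norm_nonneg _))
      exact Real.le_sqrt_of_sq_le (h1 hm)
    intro hcon
    rw [nhdsWithin_Ioo_eq_nhdsGT ht.2] at hcon
    obtain ⟨b, hb, hsub⟩ := (mem_nhdsGT_iff_exists_Ioo_subset' ht.2).1 hcon
    have hpos : 0 < volume (Ioo t (min b T)) := by
      rw [Real.volume_Ioo, ENNReal.ofReal_pos, sub_pos]
      exact lt_min hb ht.2
    refine hpos.ne' (measure_mono_null (fun s hs => ?_) (ae_iff.1 hae'))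
    intro hall
    exact hsub ⟨hs.1, hs.2.trans_le (min_le_left _ _)⟩
      (hall ⟨ht.1.trans_lt hs.1, hs.2.trans_le (min_le_right _ _)⟩)
  have hle : inner ℝ (φ t) (φ t) ≤ √N * ‖φ t‖ := by
    by_contra! hlt
    exact hfreq ((hc.eventually_const_lt hlt).mono fun s hs => not_le.2 hs)
  rw [real_inner_self_eq_norm_sq] at hle
  have h0 := norm_nonneg (φ t)
  nlinarith [Real.sq_sqrt hN, Real.sqrt_nonneg N, sq_nonneg (√N - ‖φ t‖)]

lemma integral_sub_const_sq_le {Ω : Set Plane} (hfin : volume Ω ≠ ⊤) (f : L2 Ω) {c : ℝ}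
    (hc : |c| ≤ 1) :
    ∫ x in Ω, (f x - c) ^ 2 ≤ 2 * ‖f‖ ^ 2 + 2 * volume.real Ω := by
  have : IsFiniteMeasure (volume.restrict Ω) := ⟨by simpa using hfin.lt_top⟩
  have i2 : IntegrableOn (fun x => f x ^ 2) Ω := (Lp.memLp f).integrable_sq
  have e : ‖f‖ ^ 2 = ∫ x in Ω, f x ^ 2 := by
    rw [← real_inner_self_eq_norm_sq, l2_inner_eq]
    simp only [sq]
  have e2 : 2 * ‖f‖ ^ 2 + 2 * volume.real Ω = ∫ x in Ω, (2 * f x ^ 2 + 2) := by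
    rw [integral_add (i2.const_mul 2) (integrable_const _), integral_const_mul, ← e]
    simp [mul_comm]
  rw [e2]
  refine integral_mono (((Lp.memLp f).sub (memLp_const c)).integrable_sq)
    ((i2.const_mul 2).add (integrable_const _)) fun x => ?_
  have : c ^ 2 ≤ 1 := by rw [← sq_abs]; exact pow_le_one₀ (abs_nonneg _) hc
  beta_reduce
  nlinarith [sq_nonneg (f x + c)]

lemma isBounded_of_norm_sq_le {Ω : Set Plane} (A B : ℝ) :
    Bornology.IsBounded {x : State Ω | ‖x.fst‖ ^ 2 ≤ A ∧ ‖x.snd‖ ^ 2 ≤ B} := by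
  refine isBounded_iff_forall_norm_le.2 ⟨√A + √B, fun x hx => ?_⟩
  rw [WithLp.prod_norm_eq_of_L1]
  exact add_le_add (Real.le_sqrt_of_sq_le hx.1) (Real.le_sqrt_of_sq_le hx.2)

end NonlocalCHNS

end

/-! ### Conclusion: the dissipative estimate and its two consequences. -/

theorem mainTheorem12 (Ω : Set NonlocalCHNS.Plane) (hΩ : NonlocalCHNS.IsC11Domain Ω)
    (ν : ℝ) (hν : 0 < ν)
    (J : NonlocalCHNS.Plane → ℝ) (DJ : Fin 2 → NonlocalCHNS.Plane → ℝ)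
    (hJ : NonlocalCHNS.KernelAssumption Ω J DJ)
    (m F₁ F₂ : ℝ → ℝ) (hm : NonlocalCHNS.MobilityAssumption m)
    (hF : NonlocalCHNS.PotentialAssumption Ω J m F₁ F₂)
    (ρ : ℝ) (hρ : ρ ∈ Set.Ico (0 : ℝ) 1)
    (hcond₁ : ∀ᵐ x ∂(MeasureTheory.volume.restrict Ω), ∀ s ∈ Set.Ioo (-1 : ℝ) 1,
      0 ≤ ρ * iteratedDeriv 2 F₁ s + iteratedDeriv 2 F₂ s + NonlocalCHNS.kerA Ω J x)
    (α₀ : ℝ) (hα₀ : 0 < α₀)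
    (hcond₀ : ∀ s ∈ Set.Icc (-1 : ℝ) 1, α₀ ≤ NonlocalCHNS.mobF m F₁ s)
    (h : StrongDual ℝ (NonlocalCHNS.Vdiv Ω)) :
    (∃ η > (0 : ℝ), ∃ C ≥ (0 : ℝ), ∀ m₀ ∈ Set.Icc (0 : ℝ) 1,
      ∀ z ∈ NonlocalCHNS.weakSolutions Ω ν J DJ m (F₁ + F₂) h m₀, ∀ t : NNReal,
        ‖(z t).fst‖ ^ 2 + ∫ x in Ω, ((z t).snd x - NonlocalCHNS.mean (z 0).snd) ^ 2
          ≤ (‖(z 0).fst‖ ^ 2 + ∫ x in Ω, ((z 0).snd x - NonlocalCHNS.mean (z 0).snd) ^ 2)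
              * Real.exp (-η * t) + C) ∧
    ∀ m₀ ∈ Set.Icc (0 : ℝ) 1,
      NonlocalCHNS.PointDissipative
        (NonlocalCHNS.weakSolutions Ω ν J DJ m (F₁ + F₂) h m₀) ∧
      NonlocalCHNS.EventuallyBounded
        (NonlocalCHNS.weakSolutions Ω ν J DJ m (F₁ + F₂) h m₀) := by
  have hfin : volume Ω ≠ ⊤ := hΩ.isBounded.measure_lt_top.ne
  obtain ⟨η, hη, C, hC, hu⟩ := NonlocalCHNS.exists_velocity_bound hΩ.isOpen hΩ.isBounded hν hJ
    m (F₁ + F₂) h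
  set N := volume.real Ω
  have hN : 0 ≤ N := measureReal_nonneg
  have hvel : ∀ m₀, ∀ z ∈ NonlocalCHNS.weakSolutions Ω ν J DJ m (F₁ + F₂) h m₀, ∀ t : NNReal,
      ‖(z t).fst‖ ^ 2 ≤ ‖(z 0).fst‖ ^ 2 * Real.exp (-η * t) + C ∧ ‖(z t).snd‖ ^ 2 ≤ N := by
    rintro m₀ z ⟨-, u, φ, hsol, hz⟩ t
    -- The bounds hold strictly before the horizon, so `t + 1` is used; their constants do not
    -- depend on it.
    have ht : (t : ℝ) ∈ Set.Ico (0 : ℝ) (t + 1) := ⟨t.2, by linarith⟩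
    have hs := hsol (t + 1) (by positivity)
    rw [(hz t).1, (hz 0).1, (hz t).2]
    exact ⟨hu _ _ _ hs t ht, hs.norm_sq_le hfin ht⟩
  -- `4 * N` bounds the order parameter term: `2‖φ‖² + 2N` with `‖φ‖² ≤ N`, the initial mean having
  -- modulus at most `m₀ ≤ 1`.
  refine ⟨⟨η, hη, C + 4 * N, by positivity, fun m₀ hm₀ z hz t => ?_⟩, fun m₀ _ => ⟨?_, ?_⟩⟩
  · obtain ⟨h1, h2⟩ := hvel m₀ z hz t
    have h3 := NonlocalCHNS.integral_sub_const_sq_le hfin (z t).snd (hz.1.2.2.trans hm₀.2)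
    have h4 : 0 ≤ (∫ x in Ω, ((z 0).snd x - NonlocalCHNS.mean (z 0).snd) ^ 2)
        * Real.exp (-η * t) :=
      mul_nonneg (integral_nonneg fun x => sq_nonneg _) (Real.exp_pos _).le
    rw [add_mul]
    linarith
  -- The `1` leaves room for the decaying term, eventually below `1` along each trajectory.
  · refine ⟨_, NonlocalCHNS.isBounded_of_norm_sq_le (C + 1) N, fun z hz => ?_⟩
    have hlim : Tendsto (fun t : NNReal => ‖(z 0).fst‖ ^ 2 * Real.exp (-η * t)) atTop (𝓝 0) := by
      rw [← mul_zero (‖(z 0).fst‖ ^ 2)]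
      refine Tendsto.const_mul _ (Real.tendsto_exp_atBot.comp ?_)
      exact (tendsto_const_mul_atBot_of_neg (neg_neg_of_pos hη)).2
        (NNReal.tendsto_coe_atTop.2 tendsto_id)
    filter_upwards [hlim.eventually_lt_const zero_lt_one] with t ht
    obtain ⟨h1, h2⟩ := hvel m₀ z hz t
    exact ⟨by linarith, h2⟩
  · intro B hB
    obtain ⟨R, hR⟩ := isBounded_iff_forall_norm_le.1 hB
    -- No waiting time is needed, because the exponential factor never exceeds one.
    refine ⟨0, (NonlocalCHNS.isBounded_of_norm_sq_le (R ^ 2 + C) N).subset ?_⟩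
    rintro x ⟨z, hz, hzB, t, -, rfl⟩
    obtain ⟨h1, h2⟩ := hvel m₀ z hz t
    refine ⟨h1.trans ?_, h2⟩
    have h3 : ‖(z 0).fst‖ ≤ R := by
      refine le_trans ?_ (hR _ hzB)
      rw [WithLp.prod_norm_eq_of_L1]
      exact le_add_of_nonneg_right (norm_nonneg _)
    have h4 : Real.exp (-η * t) ≤ 1 := by
      rw [Real.exp_le_one_iff, neg_mul, neg_nonpos]
      exact mul_nonneg hη.le t.2
    have h5 : ‖(z 0).fst‖ ^ 2 ≤ R ^ 2 := pow_le_pow_left₀ (norm_nonneg _) h3 2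
    have h6 : ‖(z 0).fst‖ ^ 2 * Real.exp (-η * t) ≤ ‖(z 0).fst‖ ^ 2 :=
      mul_le_of_le_one_right (sq_nonneg _) h4
    linarith
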